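/- Let $k$ be an algebraically closed field. Group schemes are affine group schemes over $k$; for a finite group scheme all modules considered are finite-dimensional. For a finite group scheme $\mathcal N$ and finite-dimensional $\mathcal N$-modules $X,M$, let $\mathrm{rad}_{\mathcal N}(X,M)$ be the radical of $\mathrm{Hom}_{\mathcal N}(X,M)$, i.e. the space of all $f$ such that $1-gf$ is invertible for every $g\in\mathrm{Hom}_{\mathcal N}(M,X)$ (for indecomposable $X,M$ these are the homomorphisms that are not isomorphisms), let $\mathrm{rad}^2_{\mathcal N}(X,M)$ be the subspace spanned by all composites $\psi\varphi$ with $\varphi\in\mathrm{rad}_{\mathcal N}(X,Z)$, $\psi\in\mathrm{rad}_{\mathcal N}(Z,M)$, $Z$ a finite-dimensional $\mathcal N$-module, and put $\mathrm{Irr}_{\mathcal N}(X,M)=\mathrm{rad}_{\mathcal N}(X,M)/\mathrm{rad}^2_{\mathcal N}(X,M)$. Let $\mathcal H$ be a reduced group scheme, $\mathcal G\subseteq\mathcal H$ a finite closed subgroup scheme, and $\mathcal N\subseteq\mathcal G$ a closed subgroup scheme that is normal in $\mathcal H$ and such that $\mathcal G/\mathcal N$ is linearly reductive. Let $X$ and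 $M$ be $\mathcal G$-modules whose restrictions to $\mathcal N$ are indecomposable, and suppose that there is an almost split exact sequence of $\mathcal N$-modules $$\mathcal E:\quad 0\to\tau_{\mathcal N}(M)\to X^n\to M\to 0 .$$ Let $\mathcal G$ act on linear maps $X\to M$ by conjugation. Then: 1. $\mathrm{rad}_{\mathcal N}(X,M)$ is a $\mathcal G$-submodule of $\mathrm{Hom}_k(X,M)$; if the actions of $\mathcal G$ on $X$ and $M$ extend to actions of $\mathcal H$, then $\mathrm{rad}^2_{\mathcal N}(X,M)$ is a $\mathcal G$-submodule as well, so that $\mathrm{Irr}_{\mathcal N}(X,M)$ is a $\mathcal G$-module. 2. Whenever $\mathrm{rad}^2_{\mathcal N}(X,M)$ is a $\mathcal G$-submodule (in particular whenever $X$ and $M$ extend to $\mathcal H$-modules), there is a short exact sequence of $\mathcal G$-modules $$\tilde{\mathcal E}:\quad 0\to N'\to X\otimes_k\mathrm{Irr}_{\mathcal N}(X,M)\to M\to 0$$ whose restriction to $\mathcal N$ is isomorphic to $\mathcal E$, by an isomorphism of short exact sequences of $\mathcal N$-modules that is the identity on $M$. -/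

import Mathlib

open scoped TensorProduct

universe u

noncomputable section

namespace GroupSchemeModule

/-- Comultiplication of an antipode in a commutative Hopf algebra. -/
theorem comul_antipode {k B : Type u} [Field k] [CommRing B] [HopfAlgebra k B] (b : B) :
    Coalgebra.comul (R := k) (HopfAlgebra.antipode k b) =
      TensorProduct.map (HopfAlgebra.antipode k) (HopfAlgebra.antipode k)
        (TensorProduct.comm k B B (Coalgebra.comul (R := k) b)) := by
  have h1 : (WithConv.toConv (Bialgebra.comulAlgHom k B)) =
      WithConv.toConv (Algebra.TensorProduct.includeLeft : B →ₐ[k] B ⊗[k] B) *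
      WithConv.toConv (Algebra.TensorProduct.includeRight : B →ₐ[k] B ⊗[k] B) := by
    ext b
    rw [AlgHom.convMul_apply]
    change Coalgebra.comul (R := k) b = _
    generalize Coalgebra.comul (R := k) b = t
    induction t using TensorProduct.induction_on with
    | zero => simp
    | tmul a c => simp
    | add a c ha hc => rw [map_add, ← ha, ← hc]
  have h2 : (WithConv.toConv (Bialgebra.comulAlgHom k B))⁻¹ =
      (WithConv.toConv (Algebra.TensorProduct.includeRight : B →ₐ[k] B ⊗[k] B))⁻¹ *
      (WithConv.toConv (Algebra.TensorProduct.includeLeft : B →ₐ[k] B ⊗[k] B))⁻¹ := by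
    rw [h1]
    exact mul_inv_rev (G := WithConv (B →ₐ[k] B ⊗[k] B)) _ _
  have h4 : (Coalgebra.comul (R := k) (HopfAlgebra.antipode k b) : B ⊗[k] B) =
      ((WithConv.toConv (Algebra.TensorProduct.includeRight : B →ₐ[k] B ⊗[k] B))⁻¹ *
      (WithConv.toConv (Algebra.TensorProduct.includeLeft : B →ₐ[k] B ⊗[k] B))⁻¹) b :=
    congrArg (fun f : WithConv (B →ₐ[k] B ⊗[k] B) => f b) h2
  rw [h4, AlgHom.convMul_apply]
  generalize Coalgebra.comul (R := k) b = t
  induction t using TensorProduct.induction_on with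
  | zero => simp
  | tmul a c =>
    simp only [TensorProduct.comm_tmul, TensorProduct.map_tmul]
    change ((1 : B) ⊗ₜ[k] HopfAlgebra.antipode k a) * (HopfAlgebra.antipode k c ⊗ₜ[k] (1 : B)) = _
    simp
  | add a c ha hc => simp only [map_add, ha, hc]

/-- A module over the affine group scheme `G` over `k` with coordinate ring `B = k[G]`, given as a
right `B`-comodule: an element `g` of `G(S)` acts on `X ⊗ S` through
`g • x = ∑ x₀ ⊗ g(x₁)`, where `∑ x₀ ⊗ x₁` is the value of `coact` at `x`. -/
structure GMod (k B X : Type u) [Field k] [CommRing B] [HopfAlgebra k B]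
    [AddCommGroup X] [Module k X] where
  coact : X →ₗ[k] X ⊗[k] B
  coassoc : ∀ x, TensorProduct.assoc k X B B (coact.rTensor B (coact x)) =
    (Coalgebra.comul (R := k) (A := B)).lTensor X (coact x)
  counit : ∀ x, (Coalgebra.counit (R := k) (A := B)).lTensor X (coact x) = x ⊗ₜ[k] (1 : k)

namespace GMod

variable {k A B X Y : Type u} [Field k] [CommRing A] [HopfAlgebra k A]
  [CommRing B] [HopfAlgebra k B]
  [AddCommGroup X] [Module k X] [AddCommGroup Y] [Module k Y]

/-- Restriction along a homomorphism of group schemes with comorphism `p : k[H] → k[G]`. -/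
def restrict (ρ : GMod k A X) (p : A →ₐc[k] B) : GMod k B X where
  coact := (p : A →ₗ[k] B).lTensor X ∘ₗ ρ.coact
  coassoc x := by
    have key : ∀ t : X ⊗[k] A, TensorProduct.assoc k X B B
        (((p : A →ₗ[k] B).lTensor X ∘ₗ ρ.coact).rTensor B ((p : A →ₗ[k] B).lTensor X t)) =
        (TensorProduct.map (p : A →ₗ[k] B) (p : A →ₗ[k] B)).lTensor X
          (TensorProduct.assoc k X A A (ρ.coact.rTensor A t)) := by
      intro t
      induction t using TensorProduct.induction_on with
      | zero => simp
      | tmul x a =>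
        simp only [LinearMap.lTensor_tmul, LinearMap.rTensor_tmul, LinearMap.comp_apply]
        generalize ρ.coact x = s
        induction s using TensorProduct.induction_on with
        | zero => simp
        | tmul x b => simp
        | add a b ha hb => simp only [map_add, TensorProduct.add_tmul, ha, hb]
      | add a b ha hb => simp only [map_add, ha, hb]
    rw [LinearMap.comp_apply, key, ρ.coassoc]
    generalize ρ.coact x = t
    induction t using TensorProduct.induction_on with
    | zero => simp
    | tmul x a =>
      simp
    | add a b ha hb => simp only [map_add, ha, hb]
  counit x := by
    rw [LinearMap.comp_apply, ← ρ.counit x]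
    generalize ρ.coact x = t
    induction t using TensorProduct.induction_on with
    | zero => simp
    | tmul x a => simp
    | add a b ha hb => simp only [map_add, ha, hb]

/-- Homomorphisms of modules over a group scheme. -/
def IsHom (ρ : GMod k B X) (σ : GMod k B Y) (f : X →ₗ[k] Y) : Prop :=
  ∀ x, σ.coact (f x) = f.rTensor B (ρ.coact x)

/-- The subspace `W` is a submodule. -/
def IsStable (ρ : GMod k B X) (W : Submodule k X) : Prop :=
  ∀ w ∈ W, ρ.coact w ∈ LinearMap.range (W.subtype.rTensor B)

theorem rTensor_subtype_injective (W : Submodule k X) :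
    Function.Injective (W.subtype.rTensor B) :=
  Module.Flat.rTensor_preserves_injective_linearMap _ W.injective_subtype

theorem lTensor_rTensor_comm {P Q : Type u} [AddCommGroup P] [Module k P] [AddCommGroup Q]
    [Module k Q] (f : X →ₗ[k] Y) (g : P →ₗ[k] Q) (t : X ⊗[k] P) :
    g.lTensor Y (f.rTensor P t) = f.rTensor Q (g.lTensor X t) := by
  induction t using TensorProduct.induction_on with
  | zero => simp
  | tmul x a => simp
  | add a b ha hb => simp only [map_add, ha, hb]

/-- The coaction on a stable subspace. -/
def subCoact (ρ : GMod k B X) (W : Submodule k X) (h : ρ.IsStable W) : W →ₗ[k] W ⊗[k] B :=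
  (LinearEquiv.ofInjective (W.subtype.rTensor B) (rTensor_subtype_injective W)).symm.toLinearMap ∘ₗ
    (ρ.coact ∘ₗ W.subtype).codRestrict _ (fun w => h w w.2)

theorem subtype_subCoact (ρ : GMod k B X) (W : Submodule k X) (h : ρ.IsStable W) (w : W) :
    W.subtype.rTensor B (ρ.subCoact W h w) = ρ.coact w := by
  have := LinearEquiv.apply_symm_apply
    (LinearEquiv.ofInjective (W.subtype.rTensor B) (rTensor_subtype_injective W))
    ((ρ.coact ∘ₗ W.subtype).codRestrict _ (fun w => h w w.2) w)
  exact congrArg Subtype.val this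

/-- A stable subspace as a module. -/
def sub (ρ : GMod k B X) (W : Submodule k X) (h : ρ.IsStable W) : GMod k B W where
  coact := ρ.subCoact W h
  coassoc w := by
    apply Module.Flat.rTensor_preserves_injective_linearMap (M := B ⊗[k] B) _ W.injective_subtype
    have e1 : ∀ t : W ⊗[k] B, W.subtype.rTensor (B ⊗[k] B)
        (TensorProduct.assoc k W B B ((ρ.subCoact W h).rTensor B t)) =
        TensorProduct.assoc k X B B (ρ.coact.rTensor B (W.subtype.rTensor B t)) := by
      intro t
      induction t using TensorProduct.induction_on with
      | zero => simp
      | tmul w b =>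
        simp only [LinearMap.rTensor_tmul, Submodule.subtype_apply, ← subtype_subCoact ρ W h w]
        generalize ρ.subCoact W h w = s
        induction s using TensorProduct.induction_on with
        | zero => simp
        | tmul x b => simp
        | add a b ha hb => simp only [map_add, TensorProduct.add_tmul, ha, hb]
      | add a b ha hb => simp only [map_add, ha, hb]
    rw [e1, subtype_subCoact, ρ.coassoc, ← subtype_subCoact ρ W h, lTensor_rTensor_comm]
  counit w := by
    apply Module.Flat.rTensor_preserves_injective_linearMap (M := k) _ W.injective_subtype
    have := ρ.counit w
    rw [← subtype_subCoact ρ W h] at this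
    rw [← LinearMap.comp_apply, LinearMap.rTensor_comp_lTensor, ← LinearMap.lTensor_comp_rTensor,
      LinearMap.comp_apply, this]
    simp

/-- The quotient by a stable subspace as a module. -/
def quot (ρ : GMod k B X) (W : Submodule k X) (h : ρ.IsStable W) : GMod k B (X ⧸ W) where
  coact := W.liftQ (W.mkQ.rTensor B ∘ₗ ρ.coact) (by
    intro w hw
    obtain ⟨t, ht⟩ := h w hw
    have h0 : W.mkQ ∘ₗ W.subtype = 0 := by ext; simp
    rw [LinearMap.mem_ker, LinearMap.comp_apply, ← ht, ← LinearMap.comp_apply,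
      ← LinearMap.rTensor_comp, h0]
    simp)
  coassoc x := by
    obtain ⟨x, rfl⟩ := W.mkQ_surjective x
    have e1 : ∀ (c : X ⧸ W →ₗ[k] (X ⧸ W) ⊗[k] B)
        (_ : ∀ x, c (W.mkQ x) = W.mkQ.rTensor B (ρ.coact x)) (t : X ⊗[k] B),
        TensorProduct.assoc k (X ⧸ W) B B (c.rTensor B (W.mkQ.rTensor B t)) =
        W.mkQ.rTensor (B ⊗[k] B) (TensorProduct.assoc k X B B (ρ.coact.rTensor B t)) := by
      intro c hc t
      induction t using TensorProduct.induction_on with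
      | zero => simp
      | tmul w b =>
        simp only [LinearMap.rTensor_tmul, hc]
        generalize ρ.coact w = s
        induction s using TensorProduct.induction_on with
        | zero => simp
        | tmul x b => simp
        | add a b ha hb => simp only [map_add, TensorProduct.add_tmul, ha, hb]
      | add a b ha hb => simp only [map_add, ha, hb]
    change TensorProduct.assoc k (X ⧸ W) B B (LinearMap.rTensor B _ (W.mkQ.rTensor B (ρ.coact x))) =
      LinearMap.lTensor _ _ (W.mkQ.rTensor B (ρ.coact x))
    rw [e1 _ (fun x => rfl), ρ.coassoc, lTensor_rTensor_comm]
  counit x := by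
    obtain ⟨x, rfl⟩ := W.mkQ_surjective x
    change LinearMap.lTensor _ _ (W.mkQ.rTensor B (ρ.coact x)) = _
    rw [← LinearMap.comp_apply, LinearMap.lTensor_comp_rTensor, ← LinearMap.rTensor_comp_lTensor,
      LinearMap.comp_apply, ρ.counit]
    simp

/-- The `n`-fold direct sum of a module. -/
def power (ρ : GMod k B X) (n : ℕ) : GMod k B (Fin n → X) where
  coact := ∑ i, (LinearMap.single k (fun _ => X) i).rTensor B ∘ₗ ρ.coact ∘ₗ LinearMap.proj i
  coassoc x := by
    have e1 : ∀ (i : Fin n) (t : X ⊗[k] B),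
        (∑ i, (LinearMap.single k (fun _ : Fin n => X) i).rTensor B ∘ₗ ρ.coact ∘ₗ
          LinearMap.proj i).rTensor B ((LinearMap.single k (fun _ : Fin n => X) i).rTensor B t) =
        ((LinearMap.single k (fun _ : Fin n => X) i).rTensor B ∘ₗ ρ.coact).rTensor B t := by
      intro i t
      rw [← LinearMap.comp_apply, ← LinearMap.rTensor_comp]
      congr 2
      ext y
      simp only [LinearMap.comp_apply, LinearMap.sum_apply]
      rw [Finset.sum_eq_single i]
      · simp
      · intro j _ hj
        simp [Pi.single_eq_of_ne hj]
      · simp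
    have e2 : ∀ (f : X →ₗ[k] (Fin n → X)) (t : (X ⊗[k] B) ⊗[k] B),
        TensorProduct.assoc k (Fin n → X) B B ((f.rTensor B).rTensor B t) =
        f.rTensor (B ⊗[k] B) (TensorProduct.assoc k X B B t) := by
      intro f t
      induction t using TensorProduct.induction_on with
      | zero => simp
      | tmul s b =>
        induction s using TensorProduct.induction_on with
        | zero => simp
        | tmul x b => simp
        | add a b ha hb => simp only [map_add, TensorProduct.add_tmul, ha, hb]
      | add a b ha hb => simp only [map_add, ha, hb]
    conv_lhs => rw [LinearMap.sum_apply, map_sum, map_sum]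
    rw [LinearMap.sum_apply, map_sum]
    refine Finset.sum_congr rfl fun i _ => ?_
    simp only [LinearMap.comp_apply]
    rw [e1, LinearMap.rTensor_comp, LinearMap.comp_apply, e2, ρ.coassoc,
      lTensor_rTensor_comm]
  counit x := by
    rw [LinearMap.sum_apply, map_sum]
    have : ∀ i, (Coalgebra.counit (R := k) (A := B)).lTensor (Fin n → X)
        (((LinearMap.single k (fun _ : Fin n => X) i).rTensor B ∘ₗ ρ.coact ∘ₗ
          LinearMap.proj i) x) = (Pi.single i (x i)) ⊗ₜ[k] (1 : k) := by
      intro i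
      rw [LinearMap.comp_apply, ← LinearMap.comp_apply, LinearMap.lTensor_comp_rTensor,
        ← LinearMap.rTensor_comp_lTensor, LinearMap.comp_apply, LinearMap.comp_apply, ρ.counit]
      simp
    simp only [this]
    rw [← TensorProduct.sum_tmul, Finset.univ_sum_single]

/-- Multiplication of the coordinate ring factors of two coactions. -/
def tensorMul (k B X Y : Type u) [Field k] [CommRing B] [HopfAlgebra k B]
    [AddCommGroup X] [Module k X] [AddCommGroup Y] [Module k Y] :
    (X ⊗[k] B) ⊗[k] (Y ⊗[k] B) →ₗ[k] (X ⊗[k] Y) ⊗[k] B :=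
  (LinearMap.mul' k B).lTensor (X ⊗[k] Y) ∘ₗ
    (TensorProduct.tensorTensorTensorComm k X B Y B).toLinearMap

/-- The tensor product of two modules with the diagonal action,
`x ⊗ y ↦ ∑ (x₀ ⊗ y₀) ⊗ x₁ y₁`. -/
def tensor (ρ : GMod k B X) (σ : GMod k B Y) : GMod k B (X ⊗[k] Y) where
  coact := tensorMul k B X Y ∘ₗ TensorProduct.map ρ.coact σ.coact
  coassoc z := by
    let T : (X ⊗[k] (B ⊗[k] B)) ⊗[k] (Y ⊗[k] (B ⊗[k] B)) →ₗ[k] (X ⊗[k] Y) ⊗[k] (B ⊗[k] B) :=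
      (LinearMap.mul' k (B ⊗[k] B)).lTensor (X ⊗[k] Y) ∘ₗ
        (TensorProduct.tensorTensorTensorComm k X (B ⊗[k] B) Y (B ⊗[k] B)).toLinearMap
    have e0 : ∀ (s : X ⊗[k] B) (t : Y ⊗[k] B) (b c : B),
        TensorProduct.assoc k (X ⊗[k] Y) B B (tensorMul k B X Y (s ⊗ₜ t) ⊗ₜ (b * c)) =
        T (TensorProduct.assoc k X B B (s ⊗ₜ b) ⊗ₜ TensorProduct.assoc k Y B B (t ⊗ₜ c)) := by
      intro s t b c
      induction s using TensorProduct.induction_on with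
      | zero => simp
      | tmul x b =>
        induction t using TensorProduct.induction_on with
        | zero => simp
        | tmul y c => simp [T, tensorMul]
        | add a b ha hb => simp only [map_add, TensorProduct.add_tmul, TensorProduct.tmul_add, ha, hb]
      | add a b ha hb => simp only [map_add, TensorProduct.add_tmul, ha, hb]
    have e1 : ∀ (s : X ⊗[k] B) (t : Y ⊗[k] B),
        TensorProduct.assoc k (X ⊗[k] Y) B B
          ((tensorMul k B X Y ∘ₗ TensorProduct.map ρ.coact σ.coact).rTensor B
            (tensorMul k B X Y (s ⊗ₜ t))) =
        T (TensorProduct.assoc k X B B (ρ.coact.rTensor B s) ⊗ₜ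
          TensorProduct.assoc k Y B B (σ.coact.rTensor B t)) := by
      intro s t
      induction s using TensorProduct.induction_on with
      | zero => simp
      | tmul x b =>
        induction t using TensorProduct.induction_on with
        | zero => simp
        | tmul y c =>
          rw [LinearMap.rTensor_tmul, LinearMap.rTensor_tmul, ← e0]
          simp [tensorMul]
        | add a b ha hb => simp only [map_add, TensorProduct.tmul_add, ha, hb]
      | add a b ha hb => simp only [map_add, TensorProduct.add_tmul, ha, hb]
    have e2 : ∀ (s : X ⊗[k] B) (t : Y ⊗[k] B),
        (Coalgebra.comul (R := k) (A := B)).lTensor (X ⊗[k] Y) (tensorMul k B X Y (s ⊗ₜ t)) =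
        T ((Coalgebra.comul (R := k) (A := B)).lTensor X s ⊗ₜ
          (Coalgebra.comul (R := k) (A := B)).lTensor Y t) := by
      intro s t
      induction s using TensorProduct.induction_on with
      | zero => simp
      | tmul x b =>
        induction t using TensorProduct.induction_on with
        | zero => simp
        | tmul y c => simp [T, tensorMul]
        | add a b ha hb => simp only [map_add, TensorProduct.tmul_add, ha, hb]
      | add a b ha hb => simp only [map_add, TensorProduct.add_tmul, ha, hb]
    induction z using TensorProduct.induction_on with
    | zero => simp
    | tmul x y =>
      rw [LinearMap.comp_apply, TensorProduct.map_tmul, e1, e2, ρ.coassoc, σ.coassoc]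
    | add a b ha hb => simp only [map_add, ha, hb]
  counit z := by
    have e2 : ∀ (s : X ⊗[k] B) (t : Y ⊗[k] B),
        (Coalgebra.counit (R := k) (A := B)).lTensor (X ⊗[k] Y) (tensorMul k B X Y (s ⊗ₜ t)) =
        ((LinearMap.mul' k k).lTensor (X ⊗[k] Y) ∘ₗ
          (TensorProduct.tensorTensorTensorComm k X k Y k).toLinearMap)
          ((Coalgebra.counit (R := k) (A := B)).lTensor X s ⊗ₜ
          (Coalgebra.counit (R := k) (A := B)).lTensor Y t) := by
      intro s t
      induction s using TensorProduct.induction_on with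
      | zero => simp
      | tmul x b =>
        induction t using TensorProduct.induction_on with
        | zero => simp
        | tmul y c => simp [tensorMul]
        | add a b ha hb => simp only [map_add, TensorProduct.tmul_add, ha, hb]
      | add a b ha hb => simp only [map_add, TensorProduct.add_tmul, ha, hb]
    induction z using TensorProduct.induction_on with
    | zero => simp
    | tmul x y =>
      rw [LinearMap.comp_apply, TensorProduct.map_tmul, e2, ρ.counit, σ.counit]
      simp
    | add a b ha hb => simp only [map_add, ha, hb, TensorProduct.add_tmul]

/-- `φ ↦ (x ↦ ∑ φ(x₀)₀ ⊗ φ(x₀)₁ S(x₁))`. -/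
def conjMap (ρ : GMod k B X) (σ : GMod k B Y) : (X →ₗ[k] Y) →ₗ[k] (X →ₗ[k] Y ⊗[k] B) where
  toFun φ := (LinearMap.mul' k B).lTensor Y ∘ₗ (TensorProduct.assoc k Y B B).toLinearMap ∘ₗ
    TensorProduct.map (σ.coact ∘ₗ φ) (HopfAlgebra.antipode k) ∘ₗ ρ.coact
  map_add' φ ψ := by
    simp only [LinearMap.comp_add, TensorProduct.map_add_left, LinearMap.add_comp]
  map_smul' c φ := by
    simp only [LinearMap.comp_smul, TensorProduct.map_smul_left, LinearMap.smul_comp,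
      RingHom.id_apply]

/-- The space of all linear maps with the action by conjugation `(g • φ)(x) = g φ(g⁻¹ x)`.
Its coaction is `conjMap`, read through the isomorphism `Hom(X, Y) ⊗ B ≃ Hom(X, Y ⊗ B)`. -/
def hom [FiniteDimensional k X] (ρ : GMod k B X) (σ : GMod k B Y) : GMod k B (X →ₗ[k] Y) where
  coact := (rTensorHomEquivHomRTensor k X Y B).symm.toLinearMap ∘ₗ conjMap ρ σ
  coassoc φ := by
    set E := rTensorHomEquivHomRTensor k X Y B with hE
    set E2 := rTensorHomEquivHomRTensor k X Y (B ⊗[k] B) with hE2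
    have hEt : ∀ (φ : X →ₗ[k] Y) (b : B) (x : X), E (φ ⊗ₜ b) x = φ x ⊗ₜ b := by
      intro φ b x; simp [hE]
    have hE2t : ∀ (φ : X →ₗ[k] Y) (b : B ⊗[k] B) (x : X), E2 (φ ⊗ₜ b) x = φ x ⊗ₜ b := by
      intro φ b x; simp [hE2]
    let V (Z : Type u) [AddCommGroup Z] [Module k Z] (h : Z →ₗ[k] Y ⊗[k] (B ⊗[k] B)) :
        Z ⊗[k] B →ₗ[k] Y ⊗[k] (B ⊗[k] B) :=
      (LinearMap.mul' k (B ⊗[k] B)).lTensor Y ∘ₗ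
        (TensorProduct.assoc k Y (B ⊗[k] B) (B ⊗[k] B)).toLinearMap ∘ₗ
        TensorProduct.map h ((TensorProduct.mk k B B).flip 1 ∘ₗ HopfAlgebra.antipode k)
    let q : Y ⊗[k] B →ₗ[k] Y ⊗[k] (B ⊗[k] B) :=
      (TensorProduct.assoc k Y B B).toLinearMap ∘ₗ σ.coact.rTensor B
    let T (φ : X →ₗ[k] Y) : X ⊗[k] B →ₗ[k] Y ⊗[k] B :=
      (LinearMap.mul' k B).lTensor Y ∘ₗ (TensorProduct.assoc k Y B B).toLinearMap ∘ₗ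
        TensorProduct.map (σ.coact ∘ₗ φ) (HopfAlgebra.antipode k)
    have hT : ∀ φ, conjMap ρ σ φ = T φ ∘ₗ ρ.coact := fun φ => rfl
    have h1a : ∀ (u : (X →ₗ[k] Y) ⊗[k] B) (b : B) (x : X),
        E2 (TensorProduct.assoc k _ B B (u ⊗ₜ b)) x = TensorProduct.assoc k Y B B (E u x ⊗ₜ b) := by
      intro u b x
      induction u using TensorProduct.induction_on with
      | zero => simp
      | tmul φ c => simp [hEt, hE2t]
      | add a b ha hb =>
        simp only [map_add, TensorProduct.add_tmul, LinearMap.add_apply, ha, hb]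
    have h1b : ∀ (φ : X →ₗ[k] Y) (b : B) (s : X ⊗[k] B),
        TensorProduct.assoc k Y B B (T φ s ⊗ₜ b) = V X (q ∘ₗ E (φ ⊗ₜ b)) s := by
      intro φ b s
      induction s using TensorProduct.induction_on with
      | zero => simp
      | tmul x c =>
        simp only [T, V, q, LinearMap.comp_apply, TensorProduct.map_tmul, hEt,
          LinearMap.rTensor_tmul]
        generalize σ.coact (φ x) = m
        induction m using TensorProduct.induction_on with
        | zero => simp
        | tmul y a => simp
        | add a b ha hb => simp only [map_add, TensorProduct.add_tmul, ha, hb]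
      | add a b ha hb => simp only [map_add, TensorProduct.add_tmul, ha, hb]
    have h1 : ∀ (t : (X →ₗ[k] Y) ⊗[k] B) (x : X),
        E2 (TensorProduct.assoc k _ B B ((E.symm.toLinearMap ∘ₗ conjMap ρ σ).rTensor B t)) x =
          V X (q ∘ₗ E t) (ρ.coact x) := by
      intro t x
      induction t using TensorProduct.induction_on with
      | zero => simp [V]
      | tmul φ b =>
        rw [LinearMap.rTensor_tmul, h1a, ← h1b, LinearMap.comp_apply, LinearEquiv.coe_coe,
          LinearEquiv.apply_symm_apply, hT, LinearMap.comp_apply]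
      | add a b ha hb =>
        rw [map_add, map_add, map_add, LinearMap.add_apply, ha, hb]
        simp only [V, map_add, LinearMap.comp_add, TensorProduct.map_add_left,
          LinearMap.add_apply, LinearMap.comp_apply]
    have h2 : ∀ (t : (X →ₗ[k] Y) ⊗[k] B) (x : X),
        E2 ((Coalgebra.comul (R := k) (A := B)).lTensor _ t) x =
          (Coalgebra.comul (R := k) (A := B)).lTensor Y (E t x) := by
      intro t x
      induction t using TensorProduct.induction_on with
      | zero => simp
      | tmul φ b => simp [hEt, hE2t]
      | add a b ha hb => simp only [map_add, LinearMap.add_apply, ha, hb]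
    have h5 : ∀ (x : X) (d : B ⊗[k] B),
        V (X ⊗[k] B) (q ∘ₗ T φ) ((TensorProduct.assoc k X B B).symm (x ⊗ₜ d)) =
          (LinearMap.mul' k (B ⊗[k] B)).lTensor Y
            (TensorProduct.assoc k Y (B ⊗[k] B) (B ⊗[k] B) (q (σ.coact (φ x)) ⊗ₜ
              TensorProduct.map (HopfAlgebra.antipode k) (HopfAlgebra.antipode k)
                (TensorProduct.comm k B B d))) := by
      intro x d
      induction d using TensorProduct.induction_on with
      | zero => simp
      | tmul b c =>
        simp only [T, V, LinearMap.comp_apply, TensorProduct.map_tmul,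
          TensorProduct.assoc_symm_tmul, TensorProduct.comm_tmul]
        generalize σ.coact (φ x) = m
        induction m using TensorProduct.induction_on with
        | zero => simp
        | tmul y a =>
          simp only [q, LinearMap.comp_apply, LinearEquiv.coe_coe, TensorProduct.assoc_tmul,
            LinearMap.lTensor_tmul, LinearMap.mul'_apply, LinearMap.rTensor_tmul]
          generalize σ.coact y = r
          induction r using TensorProduct.induction_on with
          | zero => simp
          | tmul z e => simp
          | add a b ha hb => simp only [map_add, TensorProduct.add_tmul, ha, hb]
        | add a b ha hb => simp only [map_add, TensorProduct.add_tmul, ha, hb]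
      | add a b ha hb => simp only [map_add, TensorProduct.tmul_add, ha, hb]
    have h4 : ∀ s : X ⊗[k] B,
        V (X ⊗[k] B) (q ∘ₗ T φ) ((TensorProduct.assoc k X B B).symm
          ((Coalgebra.comul (R := k) (A := B)).lTensor X s)) =
          (Coalgebra.comul (R := k) (A := B)).lTensor Y (T φ s) := by
      intro s
      induction s using TensorProduct.induction_on with
      | zero => simp
      | tmul x b =>
        have hq : q (σ.coact (φ x)) =
          (Coalgebra.comul (R := k) (A := B)).lTensor Y (σ.coact (φ x)) := σ.coassoc (φ x)
        rw [LinearMap.lTensor_tmul, h5, ← comul_antipode, hq]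
        simp only [T, LinearMap.comp_apply, TensorProduct.map_tmul]
        generalize σ.coact (φ x) = m
        induction m using TensorProduct.induction_on with
        | zero => simp
        | tmul y a => simp
        | add a b ha hb => simp only [map_add, TensorProduct.add_tmul, ha, hb]
      | add a b ha hb => simp only [map_add, ha, hb]
    apply E2.injective
    ext x : 1
    have hEs : E ((E.symm.toLinearMap ∘ₗ conjMap ρ σ) φ) = T φ ∘ₗ ρ.coact :=
      (E.apply_symm_apply _).trans (hT φ)
    rw [h1, h2, hEs, LinearMap.comp_apply (T φ), ← h4, ← ρ.coassoc, LinearEquiv.symm_apply_apply]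
    generalize ρ.coact x = s
    induction s using TensorProduct.induction_on with
    | zero => simp
    | tmul y a => simp [V]
    | add a b ha hb => simp only [map_add, ha, hb]
  counit φ := by
    set E := rTensorHomEquivHomRTensor k X Y B with hE
    set E3 := rTensorHomEquivHomRTensor k X Y k with hE3
    have h2 : ∀ (t : (X →ₗ[k] Y) ⊗[k] B) (x : X),
        E3 ((Coalgebra.counit (R := k) (A := B)).lTensor _ t) x =
          (Coalgebra.counit (R := k) (A := B)).lTensor Y (E t x) := by
      intro t x
      induction t using TensorProduct.induction_on with
      | zero => simp
      | tmul φ b => simp [hE, hE3]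
      | add a b ha hb => simp only [map_add, LinearMap.add_apply, ha, hb]
    apply E3.injective
    ext x : 1
    rw [h2, LinearMap.comp_apply, LinearEquiv.coe_coe, LinearEquiv.apply_symm_apply]
    have h3 : ∀ s : X ⊗[k] B, (Coalgebra.counit (R := k) (A := B)).lTensor Y
        (((LinearMap.mul' k B).lTensor Y ∘ₗ (TensorProduct.assoc k Y B B).toLinearMap ∘ₗ
        TensorProduct.map (σ.coact ∘ₗ φ) (HopfAlgebra.antipode k)) s) =
        φ.rTensor k ((Coalgebra.counit (R := k) (A := B)).lTensor X s) := by
      intro s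
      induction s using TensorProduct.induction_on with
      | zero => simp
      | tmul x b =>
        have h4 : ∀ m : Y ⊗[k] B, (Coalgebra.counit (R := k) (A := B)).lTensor Y
            ((LinearMap.mul' k B).lTensor Y (TensorProduct.assoc k Y B B
              (m ⊗ₜ HopfAlgebra.antipode k b))) =
            Coalgebra.counit (R := k) b • (Coalgebra.counit (R := k) (A := B)).lTensor Y m := by
          intro m
          induction m using TensorProduct.induction_on with
          | zero => simp
          | tmul y a => 
            simp only [TensorProduct.assoc_tmul, LinearMap.lTensor_tmul, LinearMap.mul'_apply,
              Bialgebra.counit_mul, HopfAlgebra.counit_antipode, ← TensorProduct.tmul_smul,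
              smul_eq_mul, mul_comm]
          | add a b ha hb => simp only [map_add, TensorProduct.add_tmul, smul_add, ha, hb]
        simp only [LinearMap.comp_apply, TensorProduct.map_tmul, LinearEquiv.coe_coe, h4,
          σ.counit]
        simp [← TensorProduct.tmul_smul]
      | add a b ha hb => simp only [map_add, ha, hb]
    exact (h3 _).trans (by rw [ρ.counit]; simp [hE3])

/-- Homomorphisms form a set closed under inverses. -/
theorem isHom_symm {ρ : GMod k B X} {σ : GMod k B Y} (e : X ≃ₗ[k] Y)
    (h : ρ.IsHom σ e.toLinearMap) : σ.IsHom ρ e.symm.toLinearMap := by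
  intro y
  obtain ⟨x, rfl⟩ := e.surjective y
  have h' : σ.coact (e x) = e.toLinearMap.rTensor B (ρ.coact x) := h x
  have h2 : e.symm.toLinearMap.rTensor B (e.toLinearMap.rTensor B (ρ.coact x)) = ρ.coact x := by
    rw [← LinearMap.comp_apply, ← LinearMap.rTensor_comp, LinearEquiv.symm_comp,
      LinearMap.rTensor_id, LinearMap.id_apply]
  rw [h', h2]
  simp

/-- The radical `rad(X, Y)` of the space of homomorphisms from `X` to `Y`: all homomorphisms `f`
such that `1 - g f` is invertible for every homomorphism `g : Y → X`. If `X` and `Y` are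
finite-dimensional and indecomposable, these are the homomorphisms that are not isomorphisms. -/
def radical (ρ : GMod k B X) (σ : GMod k B Y) : Submodule k (X →ₗ[k] Y) where
  carrier := {f | ρ.IsHom σ f ∧
    ∀ g : Y →ₗ[k] X, σ.IsHom ρ g → Function.Bijective (LinearMap.id - g ∘ₗ f : X →ₗ[k] X)}
  add_mem' := by
    rintro f₁ f₂ ⟨h₁, r₁⟩ ⟨h₂, r₂⟩
    refine ⟨fun x => by
      rw [LinearMap.add_apply, map_add, h₁ x, h₂ x, LinearMap.rTensor_add, LinearMap.add_apply],
      fun g hg => ?_⟩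
    obtain ⟨e, hex⟩ : ∃ e : X ≃ₗ[k] X, e.toLinearMap = LinearMap.id - g ∘ₗ f₁ :=
      ⟨LinearEquiv.ofBijective _ (r₁ g hg), rfl⟩
    have he : ρ.IsHom ρ e.toLinearMap := by
      intro x
      rw [hex, LinearMap.sub_apply, map_sub, LinearMap.comp_apply, hg, h₁, LinearMap.rTensor_sub,
        LinearMap.rTensor_comp, LinearMap.sub_apply, LinearMap.comp_apply, LinearMap.rTensor_id,
        LinearMap.id_apply, LinearMap.id_apply]
    have hes := isHom_symm e he
    have hg' : σ.IsHom ρ (e.symm.toLinearMap ∘ₗ g) := by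
      intro y
      rw [LinearMap.comp_apply, hes, hg, LinearMap.rTensor_comp, LinearMap.comp_apply]
    have hb := e.bijective.comp (r₂ _ hg')
    have hfun : ⇑(LinearMap.id - g ∘ₗ (f₁ + f₂) : X →ₗ[k] X) =
        e ∘ ⇑(LinearMap.id - (e.symm.toLinearMap ∘ₗ g) ∘ₗ f₂ : X →ₗ[k] X) := by
      funext x
      have hx : e x = x - g (f₁ x) := LinearMap.congr_fun hex x
      have hy : e (e.symm (g (f₂ x))) = g (f₂ x) := e.apply_symm_apply _
      simp only [Function.comp_apply, LinearMap.sub_apply, LinearMap.comp_apply,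
        LinearMap.add_apply, LinearMap.id_apply, map_add, map_sub, LinearEquiv.coe_coe, hx, hy]
      abel
    rw [hfun]
    exact hb
  zero_mem' := ⟨fun x => by simp, fun g _ => by simpa using Function.bijective_id⟩
  smul_mem' := by
    rintro c f ⟨h, r⟩
    refine ⟨fun x => by simp [h x, LinearMap.rTensor_smul], fun g hg => ?_⟩
    have := r (c • g) (fun y => by simp [hg y, LinearMap.rTensor_smul])
    rwa [LinearMap.smul_comp, ← LinearMap.comp_smul] at this

/-- The square `rad²(X, Y)` of the radical: compositions of two radical homomorphisms through
finite-dimensional modules. -/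
def radicalSq (ρ : GMod k B X) (σ : GMod k B Y) : Submodule k (X →ₗ[k] Y) :=
  Submodule.span k {α | ∃ (Z : Type u) (_ : AddCommGroup Z) (_ : Module k Z)
    (_ : FiniteDimensional k Z) (τ : GMod k B Z) (φ : X →ₗ[k] Z) (ψ : Z →ₗ[k] Y),
    φ ∈ radical ρ τ ∧ ψ ∈ radical τ σ ∧ α = ψ ∘ₗ φ}

/-- The space `Irr(X, Y) = rad(X, Y) / rad²(X, Y)`. -/
abbrev Irr (ρ : GMod k B X) (σ : GMod k B Y) : Type u :=
  radical ρ σ ⧸ (radicalSq ρ σ).comap (radical ρ σ).subtype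

/-- A module is indecomposable if it is nonzero and not a direct sum of two nonzero submodules. -/
def IsIndecomposable (ρ : GMod k B X) : Prop :=
  Nontrivial X ∧ ∀ W₁ W₂ : Submodule k X, ρ.IsStable W₁ → ρ.IsStable W₂ → IsCompl W₁ W₂ →
    W₁ = ⊥ ∨ W₂ = ⊥

/-- Inside a stable subspace, the trace of a stable subspace is stable. -/
theorem isStable_comap (ρ : GMod k B X) {W U : Submodule k X} (hW : ρ.IsStable W)
    (hU : ρ.IsStable U) : (ρ.sub W hW).IsStable (U.comap W.subtype) := by
  intro w hw
  let V := U.comap W.subtype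
  have hex : Function.Exact (V.subtype.rTensor B) (V.mkQ.rTensor B) :=
    rTensor_exact B (LinearMap.exact_subtype_mkQ V) V.mkQ_surjective
  refine (hex _).1 ?_
  let j : (W ⧸ V) →ₗ[k] (X ⧸ U) := V.mapQ U W.subtype le_rfl
  have hj : Function.Injective j := by
    rw [← LinearMap.ker_eq_bot, Submodule.ker_mapQ]
    exact (Submodule.map_comap_eq_of_surjective V.mkQ_surjective ⊥ |> fun _ =>
      (Submodule.mkQ_map_self V))
  apply Module.Flat.rTensor_preserves_injective_linearMap (M := B) j hj
  have hc : j ∘ₗ V.mkQ = U.mkQ ∘ₗ W.subtype := rfl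
  obtain ⟨t, ht⟩ := hU w hw
  have h0 : U.mkQ ∘ₗ U.subtype = 0 := by ext; simp
  rw [← LinearMap.comp_apply, ← LinearMap.rTensor_comp, hc, LinearMap.rTensor_comp,
    LinearMap.comp_apply]
  change U.mkQ.rTensor B (W.subtype.rTensor B (ρ.subCoact W hW w)) = _
  rw [subtype_subCoact, ← ht, ← LinearMap.comp_apply, ← LinearMap.rTensor_comp, h0]
  simp

/-- Let `q` be the comorphism of the inclusion of a subgroup scheme `N` of `G`, and let `X` and `Y`
be modules over `G`. If `rad_N(X, Y)` and `rad²_N(X, Y)` are `G`-submodules of the space of linear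
maps `X → Y`, then `Irr_N(X, Y)` is a module over `G`. -/
def irr {C : Type u} [CommRing C] [HopfAlgebra k C] [FiniteDimensional k X]
    (q : B →ₐc[k] C) (ρ : GMod k B X) (σ : GMod k B Y)
    (h₁ : (ρ.hom σ).IsStable (radical (ρ.restrict q) (σ.restrict q)))
    (h₂ : (ρ.hom σ).IsStable (radicalSq (ρ.restrict q) (σ.restrict q))) :
    GMod k B (Irr (ρ.restrict q) (σ.restrict q)) :=
  ((ρ.hom σ).sub _ h₁).quot _ (isStable_comap _ h₁ h₂)

end GMod

variable {k A B C D X Y Z : Type u} [Field k] [CommRing A] [HopfAlgebra k A]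
  [CommRing B] [HopfAlgebra k B] [CommRing C] [HopfAlgebra k C] [CommRing D] [HopfAlgebra k D]
  [AddCommGroup X] [Module k X] [AddCommGroup Y] [Module k Y] [AddCommGroup Z] [Module k Z]

/-- `0 → X → Y → Z → 0` is a short exact sequence of modules over a group scheme. -/
structure IsShortExact (ρ : GMod k B X) (σ : GMod k B Y) (τ : GMod k B Z)
    (f : X →ₗ[k] Y) (g : Y →ₗ[k] Z) : Prop where
  isHom_left : ρ.IsHom σ f
  isHom_right : σ.IsHom τ g
  injective : Function.Injective f
  exact : Function.Exact f g
  surjective : Function.Surjective g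

/-- `f : X → Y` is not a split monomorphism, and every homomorphism from `X` to a
finite-dimensional module that is not a split monomorphism factors through `f`. -/
def IsLeftAlmostSplit (ρ : GMod k B X) (σ : GMod k B Y) (f : X →ₗ[k] Y) : Prop :=
  (¬ ∃ r : Y →ₗ[k] X, σ.IsHom ρ r ∧ r ∘ₗ f = LinearMap.id) ∧
  ∀ (V : Type u) [AddCommGroup V] [Module k V] [FiniteDimensional k V] (υ : GMod k B V)
    (u : X →ₗ[k] V), ρ.IsHom υ u → (¬ ∃ r : V →ₗ[k] X, υ.IsHom ρ r ∧ r ∘ₗ u = LinearMap.id) →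
    ∃ v : Y →ₗ[k] V, σ.IsHom υ v ∧ v ∘ₗ f = u

/-- `g : Y → Z` is not a split epimorphism, and every homomorphism from a finite-dimensional
module to `Z` that is not a split epimorphism factors through `g`. -/
def IsRightAlmostSplit (σ : GMod k B Y) (τ : GMod k B Z) (g : Y →ₗ[k] Z) : Prop :=
  (¬ ∃ s : Z →ₗ[k] Y, τ.IsHom σ s ∧ g ∘ₗ s = LinearMap.id) ∧
  ∀ (V : Type u) [AddCommGroup V] [Module k V] [FiniteDimensional k V] (υ : GMod k B V)
    (u : V →ₗ[k] Z), υ.IsHom τ u → (¬ ∃ s : Z →ₗ[k] V, τ.IsHom υ s ∧ u ∘ₗ s = LinearMap.id) →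
    ∃ v : V →ₗ[k] Y, υ.IsHom σ v ∧ g ∘ₗ v = u

/-- `0 → X → Y → Z → 0` is an almost split sequence (of finite-dimensional modules). -/
structure IsAlmostSplit (ρ : GMod k B X) (σ : GMod k B Y) (τ : GMod k B Z)
    (f : X →ₗ[k] Y) (g : Y →ₗ[k] Z) : Prop where
  isShortExact : IsShortExact ρ σ τ f g
  left : IsLeftAlmostSplit ρ σ f
  right : IsRightAlmostSplit σ τ g

/-- The closed subgroup scheme `N` of `H` with comorphism `r : k[H] → k[N]` is normal:
`N(S)` is a normal subgroup of `H(S)` for every commutative `k`-algebra `S`. -/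
def IsNormal (r : A →ₐc[k] C) : Prop :=
  ∀ (S : Type u) [CommRing S] [Algebra k S] (h : A →ₐ[k] S) (n : C →ₐ[k] S),
    ∃ n' : C →ₐ[k] S,
      WithConv.toConv h * WithConv.toConv (n.comp (r : A →ₐ[k] C)) *
          WithConv.toConv (h.comp (HopfAlgebra.antipodeAlgHom k A)) =
        WithConv.toConv (n'.comp (r : A →ₐ[k] C))

/-- For a closed normal subgroup scheme `N` of a finite group scheme `G`, with comorphism
`q : k[G] → k[N]`: the homomorphism `ι : D → k[G]` is the comorphism of the projection
`G → G / N`, that is, it identifies its source with the algebra of functions on `G` that are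
invariant under translation by `N`. -/
structure IsQuotient (q : B →ₐc[k] C) (ι : D →ₐc[k] B) : Prop where
  injective : Function.Injective ι
  range : ∀ b : B, b ∈ Set.range ι ↔
    (q : B →ₗ[k] C).lTensor B (Coalgebra.comul (R := k) b) = b ⊗ₜ[k] (1 : C)

/-- The group scheme with coordinate ring `D` is linearly reductive: all its finite-dimensional
modules are semisimple. -/
def IsLinearlyReductive (k D : Type u) [Field k] [CommRing D] [HopfAlgebra k D] : Prop :=
  ∀ (V : Type u) [AddCommGroup V] [Module k V] [FiniteDimensional k V] (ρ : GMod k D V)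
    (W : Submodule k V), ρ.IsStable W → ∃ W' : Submodule k V, ρ.IsStable W' ∧ IsCompl W W'

end GroupSchemeModule

end

noncomputable section

namespace GroupSchemeModule

namespace GMod

variable {k A B C D X Y Z : Type u} [Field k]
  [CommRing A] [HopfAlgebra k A] [CommRing B] [HopfAlgebra k B]
  [CommRing C] [HopfAlgebra k C] [CommRing D] [HopfAlgebra k D]
  [AddCommGroup X] [Module k X] [AddCommGroup Y] [Module k Y] [AddCommGroup Z] [Module k Z]

/-! Write `g i : X → M` for the components of the almost split map `g : Xⁿ → M`. The argument
reduces everything to `Hom_N(X, M)` and the local algebra `End_N(X)`.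

The radical. Since `g` is surjective and right almost split and `X` is indecomposable over `N`,
every `N`-homomorphism `X → M` is radical (`homs_le_radical`): a non-radical one would be an
isomorphism, and then `X` would be generated by images of radical endomorphisms, against Nakayama.
So `rad_N(X, M) = Hom_N(X, M)` is the space of `N`-invariants of `Hom_k(X, M)`, and invariants of a
normal subgroup scheme are stable (`isStable_invariants`).

Its square. A radical map to `M` factors through `g`, hence `rad²_N(X, M)` consists of the sums `∑ g
i ∘ r i` with `r i` in `rad End_N(X)` (`mem_radicalSq_iff`). Conjugation is multiplicative, so it is
enough that `rad End_N(X)` be stable under `H`. As `k` is algebraically closed, `End_N(X) = k·id +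
rad`; the coaction therefore sends a nilpotent `e` to `id ⊗ a` modulo `rad ⊗ k[H]`, and `e ^ m = 0`
forces a power of `a` to vanish. Because `k[H]` is reduced, `a = 0` (`isStable_radical_self`).

The sequence. The classes of the `g i` form a basis of `Irr_N(X, M)` (`exists_basis_irr`): they span
by right almost splitness, and a nontrivial relation would split the left-hand map. As `N` acts
trivially on `Hom_N(X, M)` and `G/N` is linearly reductive, the projection onto `Irr` has a
`G`-equivariant section `s`, and `x ⊗ y ↦ s(y)(x)` is a `G`-homomorphism `ψ : X ⊗ Irr → M`. In the
basis, `s` differs from the `g i` by elements of `rad²`, so over `N` the map `ψ` becomes `g ∘ (1 +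
R)` with `R` a matrix of radical endomorphisms and `1 + R` invertible. The sequence sought is `0 →
ker ψ → X ⊗ Irr → M → 0`. -/

/-! ### The conjugation coaction, described by the universal point of the group. -/

/-- Right multiplication on the coordinate ring factor. -/
def rmul (k B Y : Type u) [Field k] [CommRing B] [HopfAlgebra k B]
    [AddCommGroup Y] [Module k Y] : (Y ⊗[k] B) ⊗[k] B →ₗ[k] Y ⊗[k] B :=
  (LinearMap.mul' k B).lTensor Y ∘ₗ (TensorProduct.assoc k Y B B).toLinearMap

@[simp] theorem rmul_tmul (y : Y) (b c : B) : rmul k B Y ((y ⊗ₜ b) ⊗ₜ c) = y ⊗ₜ (b * c) := by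
  simp [rmul]

theorem rmul_rmul (m : Y ⊗[k] B) (b c : B) :
    rmul k B Y (rmul k B Y (m ⊗ₜ b) ⊗ₜ c) = rmul k B Y (m ⊗ₜ (b * c)) := by
  induction m using TensorProduct.induction_on with
  | zero => simp
  | tmul y a => simp [mul_assoc]
  | add a b ha hb => simp only [map_add, TensorProduct.add_tmul, ha, hb]

theorem rmul_algebraMap (m : Y ⊗[k] B) (c : k) :
    rmul k B Y (m ⊗ₜ algebraMap k B c) = c • m := by
  induction m using TensorProduct.induction_on with
  | zero => simp
  | tmul y a => simp [mul_comm a, ← Algebra.smul_def]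
  | add a b ha hb => simp only [map_add, TensorProduct.add_tmul, smul_add, ha, hb]

/-- The `B`-linear map `X ⊗ B → Y ⊗ B` given by an element of `Hom(X, Y) ⊗ B`. -/
def ev (k B X Y : Type u) [Field k] [CommRing B] [HopfAlgebra k B]
    [AddCommGroup X] [Module k X] [AddCommGroup Y] [Module k Y] :
    (X →ₗ[k] Y) ⊗[k] B →ₗ[k] X ⊗[k] B →ₗ[k] Y ⊗[k] B :=
  TensorProduct.homTensorHomMap (RingHom.id k) X B Y B ∘ₗ
    (LinearMap.mul k B).lTensor (X →ₗ[k] Y)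

@[simp] theorem ev_tmul_tmul (f : X →ₗ[k] Y) (b c : B) (x : X) :
    ev k B X Y (f ⊗ₜ b) (x ⊗ₜ c) = f x ⊗ₜ (b * c) := by
  simp [ev]

theorem ev_tmul_one (f : X →ₗ[k] Y) (s : X ⊗[k] B) :
    ev k B X Y (f ⊗ₜ 1) s = f.rTensor B s := by
  induction s using TensorProduct.induction_on with
  | zero => simp
  | tmul x b => simp
  | add a b ha hb => simp only [map_add, ha, hb]

theorem ev_rmul (t : (X →ₗ[k] Y) ⊗[k] B) (s : X ⊗[k] B) (b : B) :
    ev k B X Y t (rmul k B X (s ⊗ₜ b)) = rmul k B Y (ev k B X Y t s ⊗ₜ b) := by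
  induction t using TensorProduct.induction_on with
  | zero => simp
  | tmul f c =>
    induction s using TensorProduct.induction_on with
    | zero => simp
    | tmul x a => simp [mul_assoc]
    | add a b ha hb => simp only [map_add, TensorProduct.add_tmul, ha, hb]
  | add a b ha hb => simp only [map_add, LinearMap.add_apply, TensorProduct.add_tmul, ha, hb]

theorem ev_tmul_one_right [FiniteDimensional k X] (t : (X →ₗ[k] Y) ⊗[k] B) (x : X) :
    ev k B X Y t (x ⊗ₜ 1) = rTensorHomEquivHomRTensor k X Y B t x := by
  induction t using TensorProduct.induction_on with
  | zero => simp
  | tmul f b => simp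
  | add a b ha hb => simp only [map_add, LinearMap.add_apply, ha, hb]

theorem ev_tmul_right [FiniteDimensional k X] (t : (X →ₗ[k] Y) ⊗[k] B) (x : X) (b : B) :
    ev k B X Y t (x ⊗ₜ b) = rmul k B Y (rTensorHomEquivHomRTensor k X Y B t x ⊗ₜ b) := by
  rw [← ev_tmul_one_right, ← ev_rmul, rmul_tmul, one_mul]

/-- This is `g (g⁻¹ x) = x` for the universal point `g`. It shows that the elements `ρ.coact x`
generate `X ⊗ B` as a `B`-module, so that `B`-linear maps may be compared on them. -/
theorem rmul_coact_antipode (ρ : GMod k B X) (x : X) :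
    rmul k B X (TensorProduct.map ρ.coact (HopfAlgebra.antipode k) (ρ.coact x)) = x ⊗ₜ 1 := by
  have h1 : ∀ s : X ⊗[k] B,
      rmul k B X (TensorProduct.map ρ.coact (HopfAlgebra.antipode k) s) =
      (LinearMap.mul' k B ∘ₗ (HopfAlgebra.antipode k).lTensor B).lTensor X
        (TensorProduct.assoc k X B B (ρ.coact.rTensor B s)) := by
    intro s
    induction s using TensorProduct.induction_on with
    | zero => simp
    | tmul x b =>
      simp only [TensorProduct.map_tmul, LinearMap.rTensor_tmul]
      generalize ρ.coact x = m
      induction m using TensorProduct.induction_on with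
      | zero => simp
      | tmul y a => simp
      | add a b ha hb => simp only [map_add, TensorProduct.add_tmul, ha, hb]
    | add a b ha hb => simp only [map_add, ha, hb]
  have h2 : ∀ s : X ⊗[k] B,
      (LinearMap.mul' k B ∘ₗ (HopfAlgebra.antipode k).lTensor B).lTensor X
        ((Coalgebra.comul (R := k) (A := B)).lTensor X s) =
      (Algebra.linearMap k B).lTensor X ((Coalgebra.counit (R := k) (A := B)).lTensor X s) := by
    intro s
    induction s using TensorProduct.induction_on with
    | zero => simp
    | tmul x b => simp [HopfAlgebra.mul_antipode_lTensor_comul_apply]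
    | add a b ha hb => simp only [map_add, ha, hb]
  rw [h1, ρ.coassoc, h2, ρ.counit]
  simp

/-- The universal point of the group acts on a linear map `f` by conjugation. -/
theorem ev_hom_coact [FiniteDimensional k X] (ρ : GMod k B X) (σ : GMod k B Y) (f : X →ₗ[k] Y)
    (x : X) : ev k B X Y ((ρ.hom σ).coact f) (ρ.coact x) = σ.coact (f x) := by
  -- `T (ρ.coact x)` is `g f g⁻¹ x`. Replacing `x` by `g x` yields `σ(f x₀) S(x₁) x₂`;
  -- coassociativity groups `S(x₁) x₂`, which the antipode axiom collapses to the counit.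
  let T : X ⊗[k] B →ₗ[k] Y ⊗[k] B :=
    rmul k B Y ∘ₗ TensorProduct.map (σ.coact ∘ₗ f) (HopfAlgebra.antipode k)
  have h0 : ∀ x, rTensorHomEquivHomRTensor k X Y B ((ρ.hom σ).coact f) x = T (ρ.coact x) := by
    intro x
    change rTensorHomEquivHomRTensor k X Y B
      ((rTensorHomEquivHomRTensor k X Y B).symm (conjMap ρ σ f)) x = _
    rw [LinearEquiv.apply_symm_apply]
    rfl
  have h1 : ∀ s : X ⊗[k] B, ev k B X Y ((ρ.hom σ).coact f) s =
      rmul k B Y (T.rTensor B ((TensorProduct.assoc k X B B).symm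
        (TensorProduct.assoc k X B B (ρ.coact.rTensor B s)))) := by
    intro s
    rw [LinearEquiv.symm_apply_apply]
    induction s using TensorProduct.induction_on with
    | zero => simp
    | tmul x b => rw [ev_tmul_right, h0]; simp
    | add a b ha hb => simp only [map_add, ha, hb]
  have h2 : ∀ (x : X) (d : B ⊗[k] B),
      rmul k B Y (T.rTensor B ((TensorProduct.assoc k X B B).symm (x ⊗ₜ d))) =
      rmul k B Y (σ.coact (f x) ⊗ₜ
        LinearMap.mul' k B ((HopfAlgebra.antipode k).rTensor B d)) := by
    intro x d
    induction d using TensorProduct.induction_on with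
    | zero => simp
    | tmul b c => simp [T, rmul_rmul]
    | add a b ha hb => simp only [map_add, TensorProduct.tmul_add, ha, hb]
  have h3 : ∀ s : X ⊗[k] B, rmul k B Y (T.rTensor B ((TensorProduct.assoc k X B B).symm
        ((Coalgebra.comul (R := k) (A := B)).lTensor X s))) =
      σ.coact (f (TensorProduct.rid k X
        ((Coalgebra.counit (R := k) (A := B)).lTensor X s))) := by
    intro s
    induction s using TensorProduct.induction_on with
    | zero => simp
    | tmul x b =>
      rw [LinearMap.lTensor_tmul, h2, HopfAlgebra.mul_antipode_rTensor_comul_apply,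
        rmul_algebraMap]
      simp
    | add a b ha hb => simp only [map_add, ha, hb]
  rw [h1, ρ.coassoc, h3, ρ.counit]
  simp

/-- The relation `(g f)(g x) = g (f x)` determines `g f`, because the vectors `g x` generate `X ⊗ B`
over `B`. This replaces the explicit antipode formula for the action on `Hom` in what follows. -/
theorem hom_coact_eq_iff [FiniteDimensional k X] (ρ : GMod k B X) (σ : GMod k B Y)
    (f : X →ₗ[k] Y) (t : (X →ₗ[k] Y) ⊗[k] B) :
    (ρ.hom σ).coact f = t ↔ ∀ x, ev k B X Y t (ρ.coact x) = σ.coact (f x) := by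
  refine ⟨fun h x => h ▸ ev_hom_coact ρ σ f x, fun h => ?_⟩
  apply (rTensorHomEquivHomRTensor k X Y B).injective
  ext x : 1
  rw [← ev_tmul_one_right, ← ev_tmul_one_right, ← rmul_coact_antipode ρ x]
  generalize ρ.coact x = s
  induction s using TensorProduct.induction_on with
  | zero => simp
  | tmul x b => simp only [TensorProduct.map_tmul, ev_rmul, h, ev_hom_coact]
  | add a b ha hb => simp only [map_add, ha, hb]

theorem isHom_iff_hom_coact [FiniteDimensional k X] (ρ : GMod k B X) (σ : GMod k B Y)
    (f : X →ₗ[k] Y) : ρ.IsHom σ f ↔ (ρ.hom σ).coact f = f ⊗ₜ 1 := by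
  rw [hom_coact_eq_iff]
  simp only [ev_tmul_one, IsHom, eq_comm]

theorem restrict_coact (ρ : GMod k A X) (p : A →ₐc[k] B) (x : X) :
    (ρ.restrict p).coact x = (p : A →ₗ[k] B).lTensor X (ρ.coact x) := rfl

@[ext] theorem ext {ρ σ : GMod k B X} (h : ∀ x, ρ.coact x = σ.coact x) : ρ = σ := by
  cases ρ
  cases σ
  congr
  exact LinearMap.ext h

theorem restrict_restrict (ρ : GMod k A X) (p : A →ₐc[k] B) (q : B →ₐc[k] C) :
    (ρ.restrict p).restrict q = ρ.restrict (q.comp p) := by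
  ext x
  rw [restrict_coact, restrict_coact, restrict_coact, ← LinearMap.comp_apply,
    ← LinearMap.lTensor_comp]
  rfl

theorem ev_lTensor (p : A →ₐc[k] B) (t : (X →ₗ[k] Y) ⊗[k] A) (s : X ⊗[k] A) :
    ev k B X Y ((p : A →ₗ[k] B).lTensor _ t) ((p : A →ₗ[k] B).lTensor _ s) =
      (p : A →ₗ[k] B).lTensor _ (ev k A X Y t s) := by
  induction t using TensorProduct.induction_on with
  | zero => simp
  | tmul f c =>
    induction s using TensorProduct.induction_on with
    | zero => simp
    | tmul x a => simp
    | add a b ha hb => simp only [map_add, ha, hb]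
  | add a b ha hb => simp only [map_add, LinearMap.add_apply, ha, hb]

theorem restrict_hom [FiniteDimensional k X] (ρ : GMod k A X) (σ : GMod k A Y)
    (p : A →ₐc[k] B) : (ρ.hom σ).restrict p = (ρ.restrict p).hom (σ.restrict p) := by
  ext f : 1
  symm
  rw [hom_coact_eq_iff]
  intro x
  simp only [restrict_coact, ev_lTensor, ev_hom_coact]

/-- Composition of linear maps with coefficients in the coordinate ring. -/
def compTensor (k B X Y Z : Type u) [Field k] [CommRing B] [HopfAlgebra k B]
    [AddCommGroup X] [Module k X] [AddCommGroup Y] [Module k Y] [AddCommGroup Z] [Module k Z] :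
    (Y →ₗ[k] Z) ⊗[k] B →ₗ[k] (X →ₗ[k] Y) ⊗[k] B →ₗ[k] (X →ₗ[k] Z) ⊗[k] B :=
  TensorProduct.curry ((TensorProduct.lift (LinearMap.llcomp k X Y Z)).rTensor B ∘ₗ
    tensorMul k B (Y →ₗ[k] Z) (X →ₗ[k] Y))

@[simp] theorem compTensor_tmul (f : Y →ₗ[k] Z) (g : X →ₗ[k] Y) (b c : B) :
    compTensor k B X Y Z (f ⊗ₜ b) (g ⊗ₜ c) = (f ∘ₗ g) ⊗ₜ (b * c) := by
  simp [compTensor, tensorMul]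
  rfl

theorem ev_compTensor (t : (Y →ₗ[k] Z) ⊗[k] B) (u : (X →ₗ[k] Y) ⊗[k] B) (s : X ⊗[k] B) :
    ev k B X Z (compTensor k B X Y Z t u) s = ev k B Y Z t (ev k B X Y u s) := by
  induction t using TensorProduct.induction_on with
  | zero => simp
  | tmul f b =>
    induction u using TensorProduct.induction_on with
    | zero => simp
    | tmul g c =>
      induction s using TensorProduct.induction_on with
      | zero => simp
      | tmul x a => simp [mul_assoc]
      | add a b ha hb => simp only [map_add, ha, hb]
    | add a b ha hb => simp only [map_add, LinearMap.add_apply, ha, hb]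
  | add a b ha hb => simp only [map_add, LinearMap.add_apply, ha, hb]

/-- The conjugation action is multiplicative. -/
theorem hom_coact_comp [FiniteDimensional k X] [FiniteDimensional k Y] (ρ : GMod k B X)
    (σ : GMod k B Y) (τ : GMod k B Z) (f : Y →ₗ[k] Z) (g : X →ₗ[k] Y) :
    (ρ.hom τ).coact (f ∘ₗ g) =
      compTensor k B X Y Z ((σ.hom τ).coact f) ((ρ.hom σ).coact g) := by
  rw [hom_coact_eq_iff]
  intro x
  rw [ev_compTensor, ev_hom_coact, ev_hom_coact, LinearMap.comp_apply]

/-- Base change of an inclusion `U ∘ V ⊆ W`; with multiplicativity of the coaction it carries ideal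
properties of the radical over to coefficients in `B`. -/
theorem compTensor_mem {U : Submodule k (Y →ₗ[k] Z)} {V : Submodule k (X →ₗ[k] Y)}
    {W : Submodule k (X →ₗ[k] Z)} (h : ∀ f ∈ U, ∀ g ∈ V, f ∘ₗ g ∈ W)
    {t : (Y →ₗ[k] Z) ⊗[k] B} (ht : t ∈ LinearMap.range (U.subtype.rTensor B))
    {s : (X →ₗ[k] Y) ⊗[k] B} (hs : s ∈ LinearMap.range (V.subtype.rTensor B)) :
    compTensor k B X Y Z t s ∈ LinearMap.range (W.subtype.rTensor B) := by
  obtain ⟨t, rfl⟩ := ht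
  obtain ⟨s, rfl⟩ := hs
  induction t using TensorProduct.induction_on with
  | zero => simp
  | tmul f b =>
    induction s using TensorProduct.induction_on with
    | zero => simp
    | tmul g c =>
      exact ⟨(⟨f.1 ∘ₗ g.1, h f f.2 g g.2⟩ : W) ⊗ₜ (b * c), by simp⟩
    | add a b ha hb => rw [map_add, map_add]; exact Submodule.add_mem _ ha hb
  | add a b ha hb =>
    rw [map_add, map_add, LinearMap.add_apply]; exact Submodule.add_mem _ ha hb

/-- Evaluation `X ⊗ Hom(X, Y) → Y` is a homomorphism. -/
theorem isHom_eval [FiniteDimensional k X] (ρ : GMod k B X) (σ : GMod k B Y) :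
    (ρ.tensor (ρ.hom σ)).IsHom σ (TensorProduct.lift (LinearMap.id (R := k)
      (M := X →ₗ[k] Y)).flip) := by
  have h : ∀ (s : X ⊗[k] B) (t : (X →ₗ[k] Y) ⊗[k] B),
      (TensorProduct.lift (LinearMap.id (R := k) (M := X →ₗ[k] Y)).flip).rTensor B
        (tensorMul k B X (X →ₗ[k] Y) (s ⊗ₜ t)) = ev k B X Y t s := by
    intro s t
    induction t using TensorProduct.induction_on with
    | zero => simp
    | tmul f c =>
      induction s using TensorProduct.induction_on with
      | zero => simp
      | tmul x a => simp [tensorMul, mul_comm a]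
      | add a b ha hb => simp only [map_add, TensorProduct.add_tmul, ha, hb]
    | add a b ha hb =>
      simp only [map_add, LinearMap.add_apply, TensorProduct.tmul_add, ha, hb]
  intro z
  induction z using TensorProduct.induction_on with
  | zero => simp
  | tmul x f =>
    change _ = LinearMap.rTensor B _ (tensorMul k B X (X →ₗ[k] Y)
      (ρ.coact x ⊗ₜ (ρ.hom σ).coact f))
    rw [h, ev_hom_coact]
    simp
  | add a b ha hb => simp only [map_add, ha, hb]

/-! ### Stability criteria, and invariants of a normal subgroup scheme. -/

theorem isStable_iff_rTensor_mkQ (ρ : GMod k B X) (W : Submodule k X) :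
    ρ.IsStable W ↔ ∀ w ∈ W, W.mkQ.rTensor B (ρ.coact w) = 0 := by
  have hex : Function.Exact (W.subtype.rTensor B) (W.mkQ.rTensor B) :=
    rTensor_exact B (LinearMap.exact_subtype_mkQ W) W.mkQ_surjective
  exact forall₂_congr fun w _ => (hex _).symm

/-- Flatness over a field: forming kernels commutes with `- ⊗ B`. -/
theorem mem_range_rTensor_ker (κ : X →ₗ[k] Y) (t : X ⊗[k] B) :
    t ∈ LinearMap.range ((LinearMap.ker κ).subtype.rTensor B) ↔ κ.rTensor B t = 0 := by
  have hex : Function.Exact ((LinearMap.ker κ).subtype.rTensor B) (κ.rTensor B) :=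
    Module.Flat.rTensor_exact B (LinearMap.exact_subtype_ker_map κ)
  exact (hex t).symm

/-- The invariants of a module. -/
def invariants (ρ : GMod k C X) : Submodule k X :=
  LinearMap.ker (ρ.coact - (TensorProduct.mk k X C).flip 1)

theorem mem_invariants (ρ : GMod k C X) (x : X) : x ∈ ρ.invariants ↔ ρ.coact x = x ⊗ₜ 1 := by
  simp [invariants, sub_eq_zero]

/-- The product of two points acts as their composite. -/
theorem lTensor_convMul_coact (ρ : GMod k A X) {S : Type u} [CommRing S] [Algebra k S]
    (s t : A →ₐ[k] S) (x : X) :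
    (WithConv.toConv s * WithConv.toConv t).ofConv.toLinearMap.lTensor X (ρ.coact x) =
      (LinearMap.mul' k S).lTensor X (TensorProduct.assoc k X S S
        (TensorProduct.map (s.toLinearMap.lTensor X ∘ₗ ρ.coact) t.toLinearMap (ρ.coact x))) := by
  have h1 : ∀ u : X ⊗[k] A, TensorProduct.assoc k X S S
        (TensorProduct.map (s.toLinearMap.lTensor X ∘ₗ ρ.coact) t.toLinearMap u) =
      (TensorProduct.map s.toLinearMap t.toLinearMap).lTensor X
        (TensorProduct.assoc k X A A (ρ.coact.rTensor A u)) := by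
    intro u
    induction u using TensorProduct.induction_on with
    | zero => simp
    | tmul x a =>
      simp only [TensorProduct.map_tmul, LinearMap.rTensor_tmul, LinearMap.comp_apply]
      generalize ρ.coact x = m
      induction m using TensorProduct.induction_on with
      | zero => simp
      | tmul y a => simp
      | add a b ha hb => simp only [map_add, TensorProduct.add_tmul, ha, hb]
    | add a b ha hb => simp only [map_add, ha, hb]
  rw [h1, ρ.coassoc, ← LinearMap.comp_apply (LinearMap.lTensor X (LinearMap.mul' k S)),
    ← LinearMap.lTensor_comp, ← LinearMap.comp_apply (LinearMap.lTensor X _) (LinearMap.lTensor X _),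
    ← LinearMap.lTensor_comp]
  congr 2

/-- The invariants of a normal subgroup scheme form a submodule. -/
theorem isStable_invariants (ρ : GMod k A X) (r : A →ₐc[k] C) (hr : IsNormal r) :
    ρ.IsStable (ρ.restrict r).invariants := by
  intro v hv
  rw [mem_invariants, restrict_coact] at hv
  let h : A →ₐ[k] A ⊗[k] C := Algebra.TensorProduct.includeLeft
  let n : C →ₐ[k] A ⊗[k] C := Algebra.TensorProduct.includeRight
  -- Here `h` and `n` are the universal points of `H` and `N` over `A ⊗ C`. Normality is applied to
  -- `h⁻¹`, so that `h⁻¹ n h = n'` turns into `n h = h n'`; then `n (h v) = h (n' v) = h v` for an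
  -- invariant `v`.
  obtain ⟨n', hn'⟩ := hr (A ⊗[k] C) (h.comp (HopfAlgebra.antipodeAlgHom k A)) n
  have hmul : WithConv.toConv (n.comp (r : A →ₐ[k] C)) * WithConv.toConv h =
      WithConv.toConv h * WithConv.toConv (n'.comp (r : A →ₐ[k] C)) := by
    rw [← hn']
    have e1 : WithConv.toConv (h.comp (HopfAlgebra.antipodeAlgHom k A)) =
      (WithConv.toConv h)⁻¹ := rfl
    have e2 : WithConv.toConv ((h.comp (HopfAlgebra.antipodeAlgHom k A)).comp
      (HopfAlgebra.antipodeAlgHom k A)) = (WithConv.toConv h)⁻¹⁻¹ := rfl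
    have e3 : (WithConv.toConv h)⁻¹⁻¹ = WithConv.toConv h :=
      inv_inv (G := WithConv (A →ₐ[k] A ⊗[k] C)) _
    have e4 : WithConv.toConv h * (WithConv.toConv h)⁻¹ = 1 :=
      mul_inv_cancel (G := WithConv (A →ₐ[k] A ⊗[k] C)) _
    rw [e1, e2, e3, ← mul_assoc, ← mul_assoc, e4, one_mul]
  have key := congrArg (fun f : WithConv (A →ₐ[k] A ⊗[k] C) =>
    f.ofConv.toLinearMap.lTensor X (ρ.coact v)) hmul
  simp only [lTensor_convMul_coact] at key
  have hR : TensorProduct.map (h.toLinearMap.lTensor X ∘ₗ ρ.coact)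
      (n'.comp (r : A →ₐ[k] C)).toLinearMap (ρ.coact v) =
      h.toLinearMap.lTensor X (ρ.coact v) ⊗ₜ 1 := by
    have : TensorProduct.map (h.toLinearMap.lTensor X ∘ₗ ρ.coact)
      (n'.comp (r : A →ₐ[k] C)).toLinearMap =
      TensorProduct.map (h.toLinearMap.lTensor X ∘ₗ ρ.coact) n'.toLinearMap ∘ₗ
        (r : A →ₗ[k] C).lTensor X := by
      ext x a
      simp
    rw [this, LinearMap.comp_apply, hv]
    simp
  rw [hR] at key
  -- Up to reordering the tensor factors, `n h v - h v` is the map defining the invariants, base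
  -- changed to `A` and evaluated at `ρ.coact v`. Its vanishing says that `ρ.coact v` has
  -- coefficients in the invariants.
  have hK : ∀ u : X ⊗[k] A, (LinearMap.mul' k (A ⊗[k] C)).lTensor X
      (TensorProduct.assoc k X _ _ (TensorProduct.map
        ((n.comp (r : A →ₐ[k] C)).toLinearMap.lTensor X ∘ₗ ρ.coact) h.toLinearMap u)) -
      (LinearMap.mul' k (A ⊗[k] C)).lTensor X
        (TensorProduct.assoc k X _ _ (h.toLinearMap.lTensor X u ⊗ₜ 1)) =
      ((TensorProduct.comm k C A).toLinearMap.lTensor X ∘ₗ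
        (TensorProduct.assoc k X C A).toLinearMap)
        (((ρ.restrict r).coact - (TensorProduct.mk k X C).flip 1).rTensor A u) := by
    intro u
    induction u using TensorProduct.induction_on with
    | zero => simp
    | tmul x a =>
      simp only [LinearMap.rTensor_tmul, LinearMap.sub_apply, restrict_coact,
        TensorProduct.sub_tmul, map_sub, TensorProduct.map_tmul, LinearMap.comp_apply]
      congr 1
      · generalize ρ.coact x = m
        induction m using TensorProduct.induction_on with
        | zero => simp
        | tmul y b => simp [h, n]
        | add a b ha hb => simp only [map_add, TensorProduct.add_tmul, ha, hb]
      · simp [h]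
    | add a b ha hb =>
      simp only [map_add, TensorProduct.add_tmul, ← ha, ← hb]
      abel
  rw [invariants, mem_range_rTensor_ker]
  have hinj : Function.Injective ((TensorProduct.comm k C A).toLinearMap.lTensor X ∘ₗ
        (TensorProduct.assoc k X C A).toLinearMap) :=
    ((TensorProduct.congr (LinearEquiv.refl k X)
      (TensorProduct.comm k C A)).injective).comp (TensorProduct.assoc k X C A).injective
  apply hinj
  rw [← hK, map_zero, sub_eq_zero, key]

/-! ### Passage to subgroup schemes. -/

theorem IsStable.restrict {ρ : GMod k A X} {W : Submodule k X} (h : ρ.IsStable W)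
    (p : A →ₐc[k] B) : (ρ.restrict p).IsStable W := by
  rw [isStable_iff_rTensor_mkQ] at h ⊢
  intro w hw
  rw [restrict_coact, ← lTensor_rTensor_comm, h w hw, map_zero]

theorem convMul_comp_bialgHom {S : Type u} [CommRing S] [Algebra k S] (p : A →ₐc[k] B)
    (s t : B →ₐ[k] S) :
    WithConv.toConv ((WithConv.toConv s * WithConv.toConv t).ofConv.comp (p : A →ₐ[k] B)) =
      WithConv.toConv (s.comp (p : A →ₐ[k] B)) * WithConv.toConv (t.comp (p : A →ₐ[k] B)) :=
  congrArg WithConv.toConv (AlgHom.convMul_comp_bialgHom_distrib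
    (WithConv.toConv s) (WithConv.toConv t) p)

/-- Both sides are inverse to `p` in the convolution group of algebra maps `A → B`: a homomorphism
of groups preserves inverses. -/
theorem antipodeAlgHom_comp_bialgHom (p : A →ₐc[k] B) :
    (HopfAlgebra.antipodeAlgHom k B).comp (p : A →ₐ[k] B) =
      (p : A →ₐ[k] B).comp (HopfAlgebra.antipodeAlgHom k A) := by
  have h1 : WithConv.toConv ((p : A →ₐ[k] B).comp (HopfAlgebra.antipodeAlgHom k A)) *
      WithConv.toConv (p : A →ₐ[k] B) = 1 :=
    inv_mul_cancel (G := WithConv (A →ₐ[k] B)) _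
  have h2 : WithConv.toConv (p : A →ₐ[k] B) *
      WithConv.toConv ((HopfAlgebra.antipodeAlgHom k B).comp (p : A →ₐ[k] B)) = 1 := by
    have := convMul_comp_bialgHom p (AlgHom.id k B) (HopfAlgebra.antipodeAlgHom k B)
    rw [AlgHom.id_comp] at this
    rw [← this]
    have h3 : WithConv.toConv (AlgHom.id k B) *
        WithConv.toConv (HopfAlgebra.antipodeAlgHom k B) = 1 :=
      mul_inv_cancel (G := WithConv (B →ₐ[k] B)) (WithConv.toConv (AlgHom.id k B))
    rw [h3]
    ext a
    change algebraMap k B (Coalgebra.counit (R := k) (p a)) =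
      algebraMap k B (Coalgebra.counit (R := k) a)
    rw [CoalgHomClass.counit_comp_apply]
  exact congrArg WithConv.ofConv (left_inv_eq_right_inv h1 h2).symm

/-- A point of `G` is a point of `H`, and surjectivity of `p` makes `G(S) → H(S)` injective, so the
conjugation identity in `H(S)` descends to `G(S)`. -/
theorem isNormal_of_comp (p : A →ₐc[k] B) (hp : Function.Surjective p) (q : B →ₐc[k] C)
    (h : IsNormal (q.comp p)) : IsNormal q := by
  intro S _ _ b n
  obtain ⟨n', hn'⟩ := h S (b.comp (p : A →ₐ[k] B)) n
  refine ⟨n', ?_⟩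
  have e : ((q.comp p : A →ₐc[k] C) : A →ₐ[k] C) =
    (q : B →ₐ[k] C).comp (p : A →ₐ[k] B) := rfl
  rw [e, AlgHom.comp_assoc, ← antipodeAlgHom_comp_bialgHom, ← AlgHom.comp_assoc,
    ← AlgHom.comp_assoc, ← AlgHom.comp_assoc, ← convMul_comp_bialgHom] at hn'
  have hn := (convMul_comp_bialgHom p (WithConv.toConv b *
    WithConv.toConv (n.comp (q : B →ₐ[k] C))).ofConv
    (b.comp (HopfAlgebra.antipodeAlgHom k B))).trans hn'
  ext x
  obtain ⟨a, rfl⟩ := hp x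
  exact congrArg (fun f : WithConv (A →ₐ[k] S) => f a) hn

/-! ### Formal properties of homomorphisms. -/

theorem IsHom.id (ρ : GMod k B X) : ρ.IsHom ρ LinearMap.id := fun x => by simp

theorem IsHom.comp {ρ : GMod k B X} {σ : GMod k B Y} {τ : GMod k B Z} {g : Y →ₗ[k] Z}
    {f : X →ₗ[k] Y} (hg : σ.IsHom τ g) (hf : ρ.IsHom σ f) : ρ.IsHom τ (g ∘ₗ f) := fun x => by
  rw [LinearMap.comp_apply, hg, hf, LinearMap.rTensor_comp, LinearMap.comp_apply]

/-- The space of homomorphisms. -/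
def homs (ρ : GMod k B X) (σ : GMod k B Y) : Submodule k (X →ₗ[k] Y) where
  carrier := {f | ρ.IsHom σ f}
  add_mem' {f g} hf hg x := by
    rw [LinearMap.add_apply, map_add, hf x, hg x, LinearMap.rTensor_add, LinearMap.add_apply]
  zero_mem' x := by simp
  smul_mem' c f hf x := by
    rw [LinearMap.smul_apply, map_smul, hf x, LinearMap.rTensor_smul, LinearMap.smul_apply]

theorem mem_homs {ρ : GMod k B X} {σ : GMod k B Y} {f : X →ₗ[k] Y} :
    f ∈ ρ.homs σ ↔ ρ.IsHom σ f := Iff.rfl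

theorem IsHom.pow {ρ : GMod k B X} {f : Module.End k X} (hf : ρ.IsHom ρ f) (n : ℕ) :
    ρ.IsHom ρ (f ^ n) := by
  induction n with
  | zero => exact IsHom.id ρ
  | succ n ih => rw [pow_succ]; exact ih.comp hf

theorem isStable_ker {ρ : GMod k B X} {σ : GMod k B Y} {f : X →ₗ[k] Y} (hf : ρ.IsHom σ f) :
    ρ.IsStable (LinearMap.ker f) := by
  intro w hw
  rw [mem_range_rTensor_ker, ← hf, LinearMap.mem_ker.1 hw, map_zero]

theorem isStable_range {ρ : GMod k B X} {σ : GMod k B Y} {f : X →ₗ[k] Y} (hf : ρ.IsHom σ f) :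
    σ.IsStable (LinearMap.range f) := by
  rintro _ ⟨x, rfl⟩
  refine ⟨f.rangeRestrict.rTensor B (ρ.coact x), ?_⟩
  rw [hf, ← LinearMap.comp_apply, ← LinearMap.rTensor_comp]
  rfl

theorem isHom_of_injective_comp {ρ : GMod k B X} {σ : GMod k B Y} {τ : GMod k B Z}
    {g : Y →ₗ[k] Z} {f : X →ₗ[k] Y} (hg : σ.IsHom τ g) (hi : Function.Injective g)
    (h : ρ.IsHom τ (g ∘ₗ f)) : ρ.IsHom σ f := fun x => by
  apply Module.Flat.rTensor_preserves_injective_linearMap (M := B) _ hi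
  rw [← hg, ← LinearMap.comp_apply (g.rTensor B), ← LinearMap.rTensor_comp, ← h,
    LinearMap.comp_apply]

theorem isHom_of_comp_surjective {ρ : GMod k B X} {σ : GMod k B Y} {τ : GMod k B Z}
    {g : Y →ₗ[k] Z} {f : X →ₗ[k] Y} (hf : ρ.IsHom σ f) (hs : Function.Surjective f)
    (h : ρ.IsHom τ (g ∘ₗ f)) : σ.IsHom τ g := fun y => by
  obtain ⟨x, rfl⟩ := hs y
  rw [hf, ← LinearMap.comp_apply (g.rTensor B), ← LinearMap.rTensor_comp, ← h,
    LinearMap.comp_apply]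

theorem isHom_subtype (ρ : GMod k B X) (W : Submodule k X) (h : ρ.IsStable W) :
    (ρ.sub W h).IsHom ρ W.subtype := fun w => (subtype_subCoact ρ W h w).symm

theorem isHom_mkQ (ρ : GMod k B X) (W : Submodule k X) (h : ρ.IsStable W) :
    ρ.IsHom (ρ.quot W h) W.mkQ := fun _ => rfl

theorem IsHom.restrict {ρ : GMod k A X} {σ : GMod k A Y} {f : X →ₗ[k] Y} (hf : ρ.IsHom σ f)
    (p : A →ₐc[k] B) : (ρ.restrict p).IsHom (σ.restrict p) f := fun x => by
  rw [restrict_coact, restrict_coact, hf, lTensor_rTensor_comm]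

/-! ### Endomorphisms of indecomposable modules, and the radical as an ideal. -/

/-- Fitting's lemma. -/
theorem IsIndecomposable.isNilpotent_or_bijective [FiniteDimensional k X] {ρ : GMod k B X}
    (h : ρ.IsIndecomposable) {e : Module.End k X} (he : ρ.IsHom ρ e) :
    IsNilpotent e ∨ Function.Bijective e := by
  -- The bound `1 ≤ n` is what lets injectivity of `e ^ n` pass to `e`.
  obtain ⟨n, hn, hc⟩ := ((Filter.eventually_ge_atTop 1).and
    (LinearMap.eventually_isCompl_ker_pow_range_pow e)).exists
  rcases h.2 _ _ (isStable_ker (he.pow n)) (isStable_range (he.pow n)) hc with h0 | h0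
  · right
    have hi : Function.Injective e := by
      rw [LinearMap.ker_eq_bot] at h0
      rw [← Nat.sub_add_cancel hn, pow_succ, Module.End.mul_eq_comp, LinearMap.coe_comp] at h0
      exact h0.of_comp
    exact ⟨hi, LinearMap.injective_iff_surjective.1 hi⟩
  · exact Or.inl ⟨n, LinearMap.range_eq_bot.1 h0⟩

theorem bijective_one_sub_of_isNilpotent {e : Module.End k X} (he : IsNilpotent e) :
    Function.Bijective (LinearMap.id - e : X →ₗ[k] X) :=
  (Module.End.isUnit_iff _).1 he.isUnit_one_sub

theorem not_isNilpotent_of_injective [Nontrivial X] {e : Module.End k X}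
    (he : Function.Injective e) : ¬ IsNilpotent e := by
  rintro ⟨n, hn⟩
  obtain ⟨x, hx⟩ := exists_ne (0 : X)
  refine hx ((he.iterate n) ?_)
  rw [← Module.End.coe_pow, hn]
  simp

/-- By Fitting, an endomorphism is nilpotent or invertible. If `e` is nilpotent then `g ∘ e` is not
injective, hence nilpotent, and `1 - g ∘ e` is invertible; if `e` is invertible, `g = e⁻¹` violates
the condition. -/
theorem IsIndecomposable.mem_radical_iff [FiniteDimensional k X] {ρ : GMod k B X}
    (h : ρ.IsIndecomposable) (e : Module.End k X) :
    e ∈ radical ρ ρ ↔ ρ.IsHom ρ e ∧ IsNilpotent e := by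
  have := h.1
  constructor
  · rintro ⟨he, hr⟩
    refine ⟨he, (h.isNilpotent_or_bijective he).resolve_right fun hb => ?_⟩
    let u := LinearEquiv.ofBijective e hb
    have hu : ρ.IsHom ρ u.symm.toLinearMap := isHom_symm u he
    have h0 : u.symm.toLinearMap ∘ₗ e = LinearMap.id := by
      ext x
      exact u.symm_apply_apply x
    have := (hr _ hu).1
    rw [h0, sub_self] at this
    obtain ⟨x, hx⟩ := exists_ne (0 : X)
    exact hx (this rfl)
  · rintro ⟨he, hn⟩
    refine ⟨he, fun g hg => ?_⟩
    refine bijective_one_sub_of_isNilpotent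
      ((h.isNilpotent_or_bijective (hg.comp he)).resolve_right fun hb => ?_)
    exact not_isNilpotent_of_injective (Function.Injective.of_comp hb.1) hn

/-- Endomorphisms of an indecomposable module are scalars up to the radical. -/
theorem IsIndecomposable.exists_sub_smul_mem_radical [IsAlgClosed k] [FiniteDimensional k X]
    {ρ : GMod k B X} (h : ρ.IsIndecomposable) {e : Module.End k X} (he : ρ.IsHom ρ e) :
    ∃ c : k, e - c • LinearMap.id ∈ radical ρ ρ := by
  have := h.1
  -- For an eigenvalue `c`, the map `e - c` has a kernel, so Fitting leaves only nilpotence.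
  obtain ⟨c, hc⟩ := Module.End.exists_eigenvalue e
  have h1 : ρ.IsHom ρ (e - c • LinearMap.id) :=
    Submodule.sub_mem (ρ.homs ρ) he (Submodule.smul_mem _ c (IsHom.id ρ))
  refine ⟨c, (h.mem_radical_iff _).2 ⟨h1, (h.isNilpotent_or_bijective h1).resolve_right
    fun hb => ?_⟩⟩
  obtain ⟨x, hx⟩ := hc.exists_hasEigenvector
  refine hx.2 (hb.1 ?_)
  simp [hx.apply_eq_smul]

theorem comp_mem_radical {ρ : GMod k B X} {σ : GMod k B Y} {τ : GMod k B Z} {g : Y →ₗ[k] Z}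
    {f : X →ₗ[k] Y} (hg : σ.IsHom τ g) (hf : f ∈ radical ρ σ) : g ∘ₗ f ∈ radical ρ τ :=
  ⟨hg.comp hf.1, fun u hu => hf.2 (u ∘ₗ g) (hu.comp hg)⟩

/-- If `x = u g f x`, then `f x` is fixed by `f u g`, hence `f x = 0` because `g` is radical, and so
`x = 0`. Finite dimension upgrades injectivity to bijectivity. -/
theorem mem_radical_comp [FiniteDimensional k X] {ρ : GMod k B X} {σ : GMod k B Y}
    {τ : GMod k B Z} {g : Y →ₗ[k] Z} {f : X →ₗ[k] Y} (hg : g ∈ radical σ τ)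
    (hf : ρ.IsHom σ f) : g ∘ₗ f ∈ radical ρ τ := by
  refine ⟨hg.1.comp hf, fun u hu => ?_⟩
  have hi : Function.Injective (LinearMap.id - u ∘ₗ g ∘ₗ f : X →ₗ[k] X) := by
    rw [injective_iff_map_eq_zero]
    intro x hx
    have h1 : x = u (g (f x)) := by simpa [sub_eq_zero] using hx
    have h2 : f x = 0 := (hg.2 (f ∘ₗ u) (hf.comp hu)).1 (by
      simp [← h1])
    rw [h1, h2, map_zero, map_zero]
  exact ⟨hi, LinearMap.injective_iff_surjective.1 hi⟩

/-- A form of Nakayama's lemma. -/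
theorem eq_zero_of_eq_sum_radical [FiniteDimensional k X] {ρ : GMod k B X} :
    ∀ {n : ℕ} (r : Fin n → Fin n → X →ₗ[k] X), (∀ i j, r i j ∈ radical ρ ρ) →
      ∀ x : Fin n → X, (∀ i, x i = ∑ j, r i j (x j)) → x = 0
  | 0, _, _, _, _ => Subsingleton.elim _ _
  | n + 1, r, hr, x, hx => by
    -- Gaussian elimination: `1 - r 0 0` is invertible, so the first equation gives `x 0`;
    -- substituting it leaves a smaller system that still has radical coefficients.
    let e : X ≃ₗ[k] X := LinearEquiv.ofBijective (LinearMap.id - LinearMap.id ∘ₗ r 0 0)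
      ((hr 0 0).2 _ (IsHom.id ρ))
    have he : ρ.IsHom ρ e.toLinearMap :=
      Submodule.sub_mem (ρ.homs ρ) (IsHom.id ρ) ((IsHom.id ρ).comp (hr 0 0).1)
    have h0 : x 0 = e.symm (∑ j : Fin n, r 0 j.succ (x j.succ)) := by
      rw [LinearEquiv.eq_symm_apply]
      have := hx 0
      rw [Fin.sum_univ_succ] at this
      change x 0 - r 0 0 (x 0) = _
      rw [sub_eq_iff_eq_add', ← this]
    have hs := eq_zero_of_eq_sum_radical
      (fun i j : Fin n => r i.succ j.succ + r i.succ 0 ∘ₗ e.symm.toLinearMap ∘ₗ r 0 j.succ)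
      (fun i j => add_mem (hr _ _) (mem_radical_comp (hr _ _)
        ((isHom_symm e he).comp (hr _ _).1))) (fun i => x i.succ) (fun i => by
        rw [hx i.succ, Fin.sum_univ_succ, h0]
        simp only [LinearMap.add_apply, LinearMap.comp_apply, LinearEquiv.coe_coe, map_sum,
          Finset.sum_add_distrib]
        rw [add_comm])
    have hs' : ∀ i : Fin n, x i.succ = 0 := fun i => congrFun hs i
    funext i
    refine Fin.cases ?_ hs' i
    rw [h0]
    simp [hs']

/-! ### Homomorphisms into and out of direct powers. -/

theorem IsHom.single (ρ : GMod k B X) {n : ℕ} (i : Fin n) :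
    ρ.IsHom (ρ.power n) (LinearMap.single k (fun _ => X) i) := by
  intro x
  simp only [power, LinearMap.sum_apply, LinearMap.comp_apply]
  rw [Finset.sum_eq_single i]
  · simp
  · intro j _ hj
    simp [Pi.single_eq_of_ne hj]
  · simp

theorem IsHom.pi {ρ : GMod k B X} {σ : GMod k B Y} {n : ℕ} {u : Fin n → X →ₗ[k] Y}
    (hu : ∀ i, ρ.IsHom σ (u i)) : ρ.IsHom (σ.power n) (LinearMap.pi u) := by
  have : LinearMap.pi u = ∑ i, LinearMap.single k (fun _ => Y) i ∘ₗ u i := by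
    ext x j
    simp [Finset.sum_apply, Pi.single_apply]
  rw [this]
  exact Submodule.sum_mem (ρ.homs (σ.power n)) fun i _ => (IsHom.single σ i).comp (hu i)

theorem IsHom.proj (ρ : GMod k B X) {n : ℕ} (i : Fin n) :
    (ρ.power n).IsHom ρ (LinearMap.proj i) := by
  intro x
  simp only [power, LinearMap.sum_apply, LinearMap.comp_apply, map_sum]
  rw [Finset.sum_eq_single i]
  · rw [← LinearMap.comp_apply (LinearMap.rTensor B _), ← LinearMap.rTensor_comp,
      LinearMap.proj_comp_single_same]
    simp
  · intro j _ hj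
    rw [← LinearMap.comp_apply (LinearMap.rTensor B _), ← LinearMap.rTensor_comp,
      LinearMap.proj_comp_single_ne _ _ _ _ hj.symm]
    simp
  · simp

theorem IsHom.sum {ρ : GMod k B X} {σ : GMod k B Y} {ι : Type*} {s : Finset ι}
    {u : ι → X →ₗ[k] Y} (hu : ∀ i ∈ s, ρ.IsHom σ (u i)) : ρ.IsHom σ (∑ i ∈ s, u i) :=
  Submodule.sum_mem (ρ.homs σ) hu

theorem apply_eq_sum_single {n : ℕ} (g : (Fin n → X) →ₗ[k] Y) (x : Fin n → X) :
    g x = ∑ i, (g ∘ₗ LinearMap.single k (fun _ => X) i) (x i) := by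
  conv_lhs => rw [← Finset.univ_sum_single x]
  simp

theorem comp_pi_eq_sum {n : ℕ} (g : (Fin n → X) →ₗ[k] Y) (r : Fin n → Z →ₗ[k] X) :
    g ∘ₗ LinearMap.pi r = ∑ i, (g ∘ₗ LinearMap.single k (fun _ => X) i) ∘ₗ r i := by
  ext x
  rw [LinearMap.comp_apply, apply_eq_sum_single]
  simp

/-! ### Radical, its square and irreducible maps through an almost split sequence. -/

/-- If `u ∘ s = 1`, then `1 - s ∘ u` is injective and kills the image of `s`, which forces `Y = 0`.
The right almost split map is there to exclude this: onto a zero module it would split. -/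
theorem _root_.GroupSchemeModule.IsRightAlmostSplit.not_split_of_mem_radical
    {ρ : GMod k C X} {σ : GMod k C Y} {τ : GMod k C Z} {g : X →ₗ[k] Y}
    (hg : IsRightAlmostSplit ρ σ g) {u : Z →ₗ[k] Y} (hu : u ∈ radical τ σ) :
    ¬ ∃ s : Y →ₗ[k] Z, σ.IsHom τ s ∧ u ∘ₗ s = LinearMap.id := by
  rintro ⟨s, hs, hus⟩
  have hus' : ∀ y, u (s y) = y := LinearMap.congr_fun hus
  have h0 : ∀ y, s y = 0 := fun y => (hu.2 s hs).1 (by simp [hus'])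
  refine hg.1 ⟨0, fun x => by simp, ?_⟩
  ext y
  rw [← hus' y, h0]
  simp

/-- If a surjective right almost split map starts at a power of an indecomposable module `X`, then every
homomorphism from `X` to its target is radical. -/
theorem homs_le_radical [FiniteDimensional k X] [FiniteDimensional k Y]
    {ρ : GMod k C X} {σ : GMod k C Y} {n : ℕ} {g : (Fin n → X) →ₗ[k] Y}
    (hX : ρ.IsIndecomposable) (hg : IsRightAlmostSplit (ρ.power n) σ g)
    (hgh : (ρ.power n).IsHom σ g) (hs : Function.Surjective g) :
    ρ.homs σ ≤ radical ρ σ := by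
  have := hX.1
  intro u hu
  refine ⟨hu, fun h hh => bijective_one_sub_of_isNilpotent
    ((hX.isNilpotent_or_bijective (hh.comp hu)).resolve_right fun hb => ?_)⟩
  let a : X ≃ₗ[k] X := LinearEquiv.ofBijective (h ∘ₗ u) hb
  have ha : ρ.IsHom ρ a.symm.toLinearMap := isHom_symm a (hh.comp hu)
  let e : Y →ₗ[k] X := a.symm.toLinearMap ∘ₗ h
  have he : σ.IsHom ρ e := ha.comp hh
  have heu : ∀ x, e (u x) = x := fun x => a.symm_apply_apply x
  -- the retract `u` of `e` is an isomorphism because the end term is indecomposable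
  have hue : ∀ y, u (e y) = y := by
    by_contra hne
    push Not at hne
    obtain ⟨y₀, hy₀⟩ := hne
    -- The idempotents `u ∘ e` and `1 - u ∘ e` sum to the identity. If neither is a split
    -- epimorphism, both factor through `g`, and adding the factorizations splits `g`.
    have h1 : ¬ ∃ s : Y →ₗ[k] Y, σ.IsHom σ s ∧ (u ∘ₗ e) ∘ₗ s = LinearMap.id := by
      rintro ⟨s, -, hs⟩
      have hs' : ∀ y, u (e (s y)) = y := fun y => LinearMap.congr_fun hs y
      apply hy₀
      rw [← hs' y₀, heu]
    have h2 : ¬ ∃ s : Y →ₗ[k] Y, σ.IsHom σ s ∧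
        (LinearMap.id - u ∘ₗ e : Y →ₗ[k] Y) ∘ₗ s = LinearMap.id := by
      rintro ⟨s, -, hs⟩
      have hs' : ∀ y, s y - u (e (s y)) = y := fun y => LinearMap.congr_fun hs y
      obtain ⟨x, hx⟩ := exists_ne (0 : X)
      have h3 := congrArg e (hs' (u x))
      rw [map_sub, heu, heu, sub_self] at h3
      exact hx h3.symm
    obtain ⟨v, hv, hv'⟩ := hg.2 Y σ _ (hu.comp he) h1
    obtain ⟨w, hw, hw'⟩ := hg.2 Y σ _
      (Submodule.sub_mem (σ.homs σ) (IsHom.id σ) (hu.comp he)) h2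
    refine hg.1 ⟨v + w, Submodule.add_mem (σ.homs _) hv hw, ?_⟩
    rw [LinearMap.comp_add, hv', hw', add_sub_cancel]
  -- An invertible component of `e ∘ g` would give a section of `g`, since `e` is now an isomorphism
  -- with inverse `u`.
  have hr : ∀ i, e ∘ₗ g ∘ₗ LinearMap.single k (fun _ => X) i ∈ radical ρ ρ := by
    intro i
    have hgi := he.comp (hgh.comp (IsHom.single ρ i))
    refine (hX.mem_radical_iff _).2 ⟨hgi,
      (hX.isNilpotent_or_bijective hgi).resolve_right fun hb => ?_⟩
    let c := LinearEquiv.ofBijective _ hb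
    have hc : ρ.IsHom ρ c.symm.toLinearMap := isHom_symm c hgi
    refine hg.1 ⟨LinearMap.single k (fun _ => X) i ∘ₗ c.symm.toLinearMap ∘ₗ e,
      (IsHom.single ρ i).comp (hc.comp he), ?_⟩
    ext y
    have h1 : e (g (Pi.single i (c.symm (e y)))) = e y := c.apply_symm_apply (e y)
    have h2 := congrArg u h1
    rw [hue, hue] at h2
    exact h2
  -- now `X` is generated by images of radical endomorphisms
  let b := Module.finBasis k X
  have hsur : ∀ x, ∃ y, e (g y) = x := fun x => by
    obtain ⟨y, hy⟩ := hs (u x)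
    exact ⟨y, by rw [hy, heu]⟩
  choose y hy using fun i => hsur (b i)
  -- Each basis vector `b j` equals `e (g (y j))`. Expanding the entries of `y j` in the same basis
  -- writes the vectors `b j` as radical combinations of themselves, so all vanish.
  have h0 := eq_zero_of_eq_sum_radical (ρ := ρ)
    (fun j l => ∑ i, b.repr (y j i) l • (e ∘ₗ g ∘ₗ LinearMap.single k (fun _ => X) i))
    (fun j l => Submodule.sum_mem _ fun i _ => Submodule.smul_mem _ _ (hr i)) b (fun j => by
      conv_lhs => rw [← hy j, ← LinearMap.comp_apply, apply_eq_sum_single]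
      simp only [LinearMap.sum_apply, LinearMap.smul_apply]
      rw [Finset.sum_comm]
      refine Finset.sum_congr rfl fun i _ => ?_
      conv_lhs => rw [← b.sum_repr (y j i)]
      rw [map_sum]
      refine Finset.sum_congr rfl fun l _ => ?_
      rw [map_smul]
      rfl)
  obtain ⟨x, hx⟩ := exists_ne (0 : X)
  apply hx
  rw [← b.sum_repr x]
  simp [h0]

theorem homs_eq_radical [FiniteDimensional k X] [FiniteDimensional k Y]
    {ρ : GMod k C X} {σ : GMod k C Y} {n : ℕ} {g : (Fin n → X) →ₗ[k] Y}
    (hX : ρ.IsIndecomposable) (hg : IsRightAlmostSplit (ρ.power n) σ g)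
    (hgh : (ρ.power n).IsHom σ g) (hs : Function.Surjective g) :
    radical ρ σ = ρ.homs σ :=
  le_antisymm (fun _ h => h.1) (homs_le_radical hX hg hgh hs)

/-- The square of the radical in terms of the right almost split map. -/
theorem mem_radicalSq_iff [FiniteDimensional k X] [FiniteDimensional k Y]
    {ρ : GMod k C X} {σ : GMod k C Y} {n : ℕ} {g : (Fin n → X) →ₗ[k] Y}
    (hX : ρ.IsIndecomposable) (hg : IsRightAlmostSplit (ρ.power n) σ g)
    (hgh : (ρ.power n).IsHom σ g) (hs : Function.Surjective g) (u : X →ₗ[k] Y) :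
    u ∈ radicalSq ρ σ ↔ ∃ r : Fin n → X →ₗ[k] X, (∀ i, r i ∈ radical ρ ρ) ∧
      u = g ∘ₗ LinearMap.pi r := by
  constructor
  · intro hu
    induction hu using Submodule.span_induction with
    | mem u hu =>
      obtain ⟨Z, _, _, _, ζ, φ, ψ, hφ, hψ, rfl⟩ := hu
      obtain ⟨v, hv, rfl⟩ := hg.2 Z ζ ψ hψ.1 (hg.not_split_of_mem_radical hψ)
      exact ⟨fun i => (LinearMap.proj i ∘ₗ v) ∘ₗ φ,
        fun i => comp_mem_radical ((IsHom.proj ρ i).comp hv) hφ, rfl⟩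
    | zero => exact ⟨fun _ => 0, fun _ => zero_mem _, LinearMap.ext fun _ => (map_zero g).symm⟩
    | add u v _ _ hu hv =>
      obtain ⟨r, hr, rfl⟩ := hu
      obtain ⟨s, hs, rfl⟩ := hv
      refine ⟨fun i => r i + s i, fun i => add_mem (hr i) (hs i), ?_⟩
      rw [← LinearMap.comp_add]
      rfl
    | smul c u _ hu =>
      obtain ⟨r, hr, rfl⟩ := hu
      refine ⟨fun i => c • r i, fun i => Submodule.smul_mem _ c (hr i), ?_⟩
      rw [← LinearMap.comp_smul]
      rfl
  · rintro ⟨r, hr, rfl⟩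
    rw [comp_pi_eq_sum]
    refine Submodule.sum_mem _ fun i _ => Submodule.subset_span ?_
    exact ⟨X, _, _, inferInstance, ρ, r i, _, hr i,
      homs_le_radical hX hg hgh hs (hgh.comp (IsHom.single ρ i)), rfl⟩

theorem comp_mem_radicalSq [FiniteDimensional k X] {ρ : GMod k C X} {σ : GMod k C Y}
    {u : X →ₗ[k] Y} (hu : u ∈ radical ρ σ) {r : X →ₗ[k] X} (hr : r ∈ radical ρ ρ) :
    u ∘ₗ r ∈ radicalSq ρ σ :=
  Submodule.subset_span ⟨X, _, _, inferInstance, ρ, r, u, hr, hu, rfl⟩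

/-- The components of the right almost split map span the irreducible maps. -/
theorem exists_sub_sum_mem_radicalSq [IsAlgClosed k] [FiniteDimensional k X]
    [FiniteDimensional k Y] {ρ : GMod k C X} {σ : GMod k C Y} {n : ℕ}
    {g : (Fin n → X) →ₗ[k] Y} (hX : ρ.IsIndecomposable)
    (hg : IsRightAlmostSplit (ρ.power n) σ g) (hgh : (ρ.power n).IsHom σ g)
    (hs : Function.Surjective g) {u : X →ₗ[k] Y} (hu : u ∈ radical ρ σ) :
    ∃ c : Fin n → k,
      u - ∑ i, c i • (g ∘ₗ LinearMap.single k (fun _ => X) i) ∈ radicalSq ρ σ := by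
  have := hX.1
  obtain ⟨v, hv, rfl⟩ := hg.2 X ρ u hu.1 (hg.not_split_of_mem_radical hu)
  -- `c i` is the residue of the `i`-th component of the lift `v : X → Xⁿ` in `End / rad = k`; the
  -- remainder is `g` after radical maps, hence in `rad²`.
  choose c hc using fun i => hX.exists_sub_smul_mem_radical ((IsHom.proj ρ i).comp hv)
  refine ⟨c, (mem_radicalSq_iff hX hg hgh hs _).2 ⟨_, hc, ?_⟩⟩
  ext x
  have h1 : ∑ i, c i • g (Pi.single i x) = g (fun i => c i • x) := by
    simp only [← map_smul, ← map_sum]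
    congr 1
    ext j
    simp [Finset.sum_apply, Pi.single_apply]
  simp only [LinearMap.sub_apply, LinearMap.comp_apply, LinearMap.sum_apply,
    LinearMap.smul_apply, LinearMap.single_apply, h1, ← map_sub]
  rfl

/-- The components of the right almost split map are independent modulo `rad²`. -/
theorem eq_zero_of_sum_mem_radicalSq {T : Type u} [AddCommGroup T] [Module k T]
    [FiniteDimensional k X] [FiniteDimensional k Y] [FiniteDimensional k T]
    {ρ : GMod k C X} {σ : GMod k C Y} {τ : GMod k C T} {n : ℕ} {f : T →ₗ[k] (Fin n → X)}
    {g : (Fin n → X) →ₗ[k] Y} (hX : ρ.IsIndecomposable)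
    (hE : IsAlmostSplit τ (ρ.power n) σ f g) (c : Fin n → k)
    (hc : ∑ i, c i • (g ∘ₗ LinearMap.single k (fun _ => X) i) ∈ radicalSq ρ σ) : c = 0 := by
  have := hX.1
  have hEx := hE.isShortExact
  obtain ⟨r, hr, hcr⟩ := (mem_radicalSq_iff hX hE.right hEx.isHom_right hEx.surjective _).1 hc
  by_contra hne
  obtain ⟨j, hj⟩ : ∃ j, c j ≠ 0 := Function.ne_iff.1 hne
  -- The assumed relation says `g ∘ U = 0`, so `U` factors as `f ∘ w`. Since `c j ≠ 0`, the `j`-th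
  -- entry of `U` is invertible and gives a retraction `d` of `U`.
  let U : X →ₗ[k] (Fin n → X) := LinearMap.pi fun i => c i • LinearMap.id - r i
  have hU : ρ.IsHom (ρ.power n) U := IsHom.pi fun i =>
    Submodule.sub_mem (ρ.homs ρ) (Submodule.smul_mem _ _ (IsHom.id ρ)) (hr i).1
  have hgU : ∀ x, g (U x) = 0 := by
    intro x
    have h1 : ∑ i, c i • g (Pi.single i x) = g (fun i => c i • x) := by
      simp only [← map_smul, ← map_sum]
      congr 1
      ext j
      simp [Finset.sum_apply, Pi.single_apply]
    have h2 := LinearMap.congr_fun hcr x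
    simp only [LinearMap.comp_apply, LinearMap.sum_apply, LinearMap.smul_apply,
      LinearMap.single_apply, h1] at h2
    rw [← sub_eq_zero, ← map_sub] at h2
    exact h2
  let w : X →ₗ[k] T := (LinearEquiv.ofInjective f hEx.injective).symm.toLinearMap ∘ₗ
    U.codRestrict (LinearMap.range f) fun x => (hEx.exact _).1 (hgU x)
  have hfw : f ∘ₗ w = U := by
    ext x : 1
    exact congrArg Subtype.val ((LinearEquiv.ofInjective f hEx.injective).apply_symm_apply
      (U.codRestrict (LinearMap.range f) (fun x => (hEx.exact _).1 (hgU x)) x))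
  have hw : ρ.IsHom τ w := isHom_of_injective_comp hEx.isHom_left hEx.injective (hfw ▸ hU)
  have hbij := (hr j).2 ((c j)⁻¹ • LinearMap.id) (Submodule.smul_mem (ρ.homs ρ) _ (IsHom.id ρ))
  let e := LinearEquiv.ofBijective _ hbij
  have he : ρ.IsHom ρ e.toLinearMap := Submodule.sub_mem (ρ.homs ρ) (IsHom.id ρ)
    (IsHom.comp (Submodule.smul_mem (ρ.homs ρ) _ (IsHom.id ρ)) (hr j).1)
  let d : (Fin n → X) →ₗ[k] X := (c j)⁻¹ • e.symm.toLinearMap ∘ₗ LinearMap.proj j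
  have hd : (ρ.power n).IsHom ρ d :=
    Submodule.smul_mem ((ρ.power n).homs ρ) _ ((isHom_symm e he).comp (IsHom.proj ρ j))
  have hdU : ∀ x, d (U x) = x := by
    intro x
    change (c j)⁻¹ • e.symm (c j • x - r j x) = x
    rw [← map_smul, LinearEquiv.symm_apply_eq]
    change _ = x - (c j)⁻¹ • r j x
    rw [smul_sub, inv_smul_smul₀ hj]
  -- `m` kills the nonzero image of `w`, so it is not a split monomorphism and extends along `f` as
  -- `v ∘ f`. Then `w ∘ d + v` is a retraction of `f`, a contradiction.
  let m : T →ₗ[k] T := LinearMap.id - w ∘ₗ d ∘ₗ f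
  have hm : τ.IsHom τ m := Submodule.sub_mem (τ.homs τ) (IsHom.id τ)
    (hw.comp (hd.comp hEx.isHom_left))
  have hmw : ∀ x, m (w x) = 0 := by
    intro x
    change w x - w (d (f (w x))) = 0
    rw [← LinearMap.comp_apply f, hfw, hdU, sub_self]
  obtain ⟨v, hv, hvf⟩ := hE.left.2 T τ m hm (by
    rintro ⟨s, -, hs⟩
    obtain ⟨x, hx⟩ := exists_ne (0 : X)
    apply hx
    have h1 : s (m (w x)) = w x := LinearMap.congr_fun hs (w x)
    rw [hmw, map_zero] at h1
    rw [← hdU x, ← hfw, LinearMap.comp_apply, ← h1, map_zero, map_zero])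
  refine hE.left.1 ⟨w ∘ₗ d + v, Submodule.add_mem ((ρ.power n).homs τ) (hw.comp hd) hv, ?_⟩
  rw [LinearMap.add_comp, hvf, LinearMap.comp_assoc]
  exact add_sub_cancel _ _

/-! ### Stability of the radical and its square. -/

section Stable

variable {M : Type u} [AddCommGroup M] [Module k M] [FiniteDimensional k X]

theorem homs_eq_invariants (ρ : GMod k A X) (σ : GMod k A M) (r : A →ₐc[k] C) :
    (ρ.restrict r).homs (σ.restrict r) = ((ρ.hom σ).restrict r).invariants := by
  ext f
  rw [mem_homs, mem_invariants, restrict_hom, isHom_iff_hom_coact]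

/-- Homomorphisms over a normal subgroup scheme form a submodule. -/
theorem isStable_homs (ρ : GMod k A X) (σ : GMod k A M) (r : A →ₐc[k] C) (hr : IsNormal r) :
    (ρ.hom σ).IsStable ((ρ.restrict r).homs (σ.restrict r)) := by
  rw [homs_eq_invariants]
  exact isStable_invariants _ r hr

/-- The decomposition `End = k·id + rad`, with coefficients extended to `A`. -/
theorem IsIndecomposable.exists_sub_id_tmul_mem [IsAlgClosed k] {ρ : GMod k C X}
    (h : ρ.IsIndecomposable) (t : (X →ₗ[k] X) ⊗[k] A)
    (ht : t ∈ LinearMap.range ((ρ.homs ρ).subtype.rTensor A)) :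
    ∃ a : A, t - LinearMap.id ⊗ₜ a ∈ LinearMap.range ((radical ρ ρ).subtype.rTensor A) := by
  obtain ⟨t, rfl⟩ := ht
  induction t using TensorProduct.induction_on with
  | zero => exact ⟨0, by simp⟩
  | tmul e b =>
    obtain ⟨c, hc⟩ := h.exists_sub_smul_mem_radical e.2
    refine ⟨c • b, ⟨_, hc⟩ ⊗ₜ b, ?_⟩
    simp [TensorProduct.sub_tmul, TensorProduct.smul_tmul]
  | add s t hs ht =>
    obtain ⟨a, ha⟩ := hs
    obtain ⟨b, hb⟩ := ht
    refine ⟨a + b, ?_⟩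
    rw [map_add, TensorProduct.tmul_add, add_sub_add_comm]
    exact add_mem ha hb

/-- The radical of the endomorphism algebra over a normal subgroup scheme of a reduced group scheme
is a submodule. -/
theorem isStable_radical_self [IsAlgClosed k] [IsReduced A] (ρ : GMod k A X) (r : A →ₐc[k] C)
    (hr : IsNormal r) (hX : (ρ.restrict r).IsIndecomposable) :
    (ρ.hom ρ).IsStable (radical (ρ.restrict r) (ρ.restrict r)) := by
  have hnt := hX.1
  intro e he
  have hstab := isStable_homs ρ ρ r hr
  obtain ⟨a, ha⟩ := hX.exists_sub_id_tmul_mem _ (hstab e he.1)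
  -- The coaction is multiplicative and the radical is an ideal, so modulo `rad ⊗ A` the class `id ⊗
  -- a` of `e` may be raised to powers.
  have hpow : ∀ m : ℕ, (ρ.hom ρ).coact ((e : Module.End k X) ^ (m + 1)) -
      (LinearMap.id : X →ₗ[k] X) ⊗ₜ[k] (a ^ (m + 1)) ∈
        LinearMap.range ((radical (ρ.restrict r) (ρ.restrict r)).subtype.rTensor A) := by
    intro m
    induction m with
    | zero => simpa using ha
    | succ m ih =>
      rw [pow_succ e, Module.End.mul_eq_comp, hom_coact_comp ρ ρ ρ]
      have h1 := compTensor_mem (B := A) (fun f hf g hg => comp_mem_radical hf hg)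
        (hstab _ (IsHom.pow (f := e) he.1 (m + 1))) ha
      have h2 := compTensor_mem (B := A) (V := (ρ.restrict r).homs (ρ.restrict r))
        (fun f hf g hg => mem_radical_comp hf hg) ih
        (s := LinearMap.id ⊗ₜ a) ⟨⟨LinearMap.id, IsHom.id _⟩ ⊗ₜ a, rfl⟩
      have h3 : compTensor k A X X X (LinearMap.id ⊗ₜ (a ^ (m + 1))) (LinearMap.id ⊗ₜ a) =
          LinearMap.id ⊗ₜ (a ^ (m + 1 + 1)) := by
        rw [compTensor_tmul, LinearMap.comp_id, ← pow_succ a]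
      convert add_mem h1 h2 using 1
      rw [map_sub, map_sub, LinearMap.sub_apply, ← h3]
      exact (sub_add_sub_cancel _ _ _).symm
  obtain ⟨-, m, hm⟩ := (hX.mem_radical_iff e).1 he
  have h0 := hpow m
  rw [pow_succ e, hm, zero_mul, map_zero, zero_sub, neg_mem_iff] at h0
  have hid : (LinearMap.id : X →ₗ[k] X) ∉ radical (ρ.restrict r) (ρ.restrict r) := fun h =>
    not_isNilpotent_of_injective Function.injective_id ((hX.mem_radical_iff _).1 h).2
  have ha0 : a = 0 := by
    obtain ⟨t, ht⟩ := h0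
    -- A functional that vanishes on the radical but not at `id` extracts the coefficient `a ^ (m +
    -- 1)`. This is where reducedness of `A` enters.
    obtain ⟨φ, hφ, hφr⟩ := Submodule.exists_le_ker_of_notMem hid
    have h1 : φ ∘ₗ (radical (ρ.restrict r) (ρ.restrict r)).subtype = 0 := by
      ext x
      exact hφr x.2
    have h2 := congrArg (TensorProduct.lid k A ∘ φ.rTensor A) ht
    rw [Function.comp_apply, ← LinearMap.comp_apply (φ.rTensor A), ← LinearMap.rTensor_comp,
      h1] at h2
    have h3 : φ LinearMap.id • a ^ (m + 1) = 0 := by simpa using h2.symm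
    exact eq_zero_of_pow_eq_zero ((smul_eq_zero.1 h3).resolve_left hφ)
  simpa [ha0] using ha

/-- The square of the radical over a normal subgroup scheme of a reduced group scheme is a
submodule, in the presence of a right almost split map. -/
theorem isStable_radicalSq [IsAlgClosed k] [IsReduced A] [FiniteDimensional k M]
    (ρ : GMod k A X) (σ : GMod k A M) (r : A →ₐc[k] C) (hr : IsNormal r) (hX : (ρ.restrict r).IsIndecomposable) {n : ℕ}
    {g : (Fin n → X) →ₗ[k] M}
    (hg : IsRightAlmostSplit ((ρ.restrict r).power n) (σ.restrict r) g)
    (hgh : ((ρ.restrict r).power n).IsHom (σ.restrict r) g) (hs : Function.Surjective g) :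
    (ρ.hom σ).IsStable (radicalSq (ρ.restrict r) (σ.restrict r)) := by
  intro u hu
  obtain ⟨e, he, rfl⟩ := (mem_radicalSq_iff hX hg hgh hs u).1 hu
  rw [comp_pi_eq_sum, map_sum]
  refine Submodule.sum_mem _ fun i _ => ?_
  rw [hom_coact_comp ρ ρ σ]
  exact compTensor_mem (fun u hu e he => comp_mem_radicalSq (homs_le_radical hX hg hgh hs hu) he)
    (isStable_homs ρ σ r hr _ (hgh.comp (IsHom.single _ i)))
    (isStable_radical_self ρ r hr hX _ (he i))

end Stable

/-! ### Modules over the quotient group scheme, and linear reductivity. -/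

section Quotient

/-- A `G`-module on which `N` acts trivially is a `G / N`-module. -/
theorem exists_restrict_eq (q : B →ₐc[k] C) (ι : D →ₐc[k] B) (hι : IsQuotient q ι)
    (ρ : GMod k B X) (h : ∀ x, (ρ.restrict q).coact x = x ⊗ₜ 1) :
    ∃ σ : GMod k D X, σ.restrict ι = ρ := by
  let i : D →ₗ[k] B := ι
  have hi : Function.Injective i := hι.injective
  have hiX : Function.Injective (i.lTensor X) :=
    Module.Flat.lTensor_preserves_injective_linearMap _ hi
  -- `D` is the kernel of `κ`. Coassociativity turns trivial `N`-action into the vanishing of `κ` on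
  -- the coefficients of `ρ.coact x`, so by flatness the coaction lands in `X ⊗ D`.
  let κ : B →ₗ[k] B ⊗[k] C := (q : B →ₗ[k] C).lTensor B ∘ₗ Coalgebra.comul (R := k) -
    (TensorProduct.mk k B C).flip 1
  have hex : Function.Exact i κ := fun b => by
    have := hι.range b
    simp only [κ, LinearMap.sub_apply, sub_eq_zero, LinearMap.comp_apply, LinearMap.flip_apply,
      TensorProduct.mk_apply, ← this]
    rfl
  have hκ : ∀ x, κ.lTensor X (ρ.coact x) = 0 := by
    intro x
    have h1 : ∀ s : X ⊗[k] B, κ.lTensor X s =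
        (LinearMap.lTensor X ((q : B →ₗ[k] C).lTensor B))
          ((Coalgebra.comul (R := k) (A := B)).lTensor X s) -
        TensorProduct.assoc k X B C (s ⊗ₜ 1) := by
      intro s
      induction s using TensorProduct.induction_on with
      | zero => simp
      | tmul x b => simp [κ]
      | add a b ha hb => simp only [map_add, TensorProduct.add_tmul, ha, hb]; abel
    have h2 : ∀ s : X ⊗[k] B, (LinearMap.lTensor X ((q : B →ₗ[k] C).lTensor B))
          (TensorProduct.assoc k X B B (ρ.coact.rTensor B s)) =
        TensorProduct.assoc k X B C (ρ.coact.rTensor C ((q : B →ₗ[k] C).lTensor X s)) := by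
      intro s
      induction s using TensorProduct.induction_on with
      | zero => simp
      | tmul x b =>
        simp only [LinearMap.rTensor_tmul, LinearMap.lTensor_tmul]
        generalize ρ.coact x = m
        induction m using TensorProduct.induction_on with
        | zero => simp
        | tmul y a => simp
        | add a b ha hb => simp only [map_add, TensorProduct.add_tmul, ha, hb]
      | add a b ha hb => simp only [map_add, ha, hb]
    rw [h1, ← ρ.coassoc, h2, ← restrict_coact, h]
    simp
  have hmem : ∀ x, ρ.coact x ∈ LinearMap.range (i.lTensor X) := fun x =>
    (Module.Flat.lTensor_exact X hex _).1 (hκ x)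
  let c : X →ₗ[k] X ⊗[k] D := (LinearEquiv.ofInjective _ hiX).symm.toLinearMap ∘ₗ
    ρ.coact.codRestrict _ hmem
  have hc : ∀ x, i.lTensor X (c x) = ρ.coact x := fun x =>
    congrArg Subtype.val ((LinearEquiv.ofInjective _ hiX).apply_symm_apply
      (ρ.coact.codRestrict _ hmem x))
  refine ⟨⟨c, fun x => ?_, fun x => ?_⟩, ext hc⟩
  · have hii : Function.Injective ((TensorProduct.map i i).lTensor X) :=
      Module.Flat.lTensor_preserves_injective_linearMap _
        (TensorProduct.map_injective_of_flat_flat i i hi hi)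
    have h1 : ∀ s : X ⊗[k] D, (TensorProduct.map i i).lTensor X
        (TensorProduct.assoc k X D D (c.rTensor D s)) =
        TensorProduct.assoc k X B B (ρ.coact.rTensor B (i.lTensor X s)) := by
      intro s
      induction s using TensorProduct.induction_on with
      | zero => simp
      | tmul x b =>
        simp only [LinearMap.rTensor_tmul, LinearMap.lTensor_tmul, ← hc]
        generalize c x = m
        induction m using TensorProduct.induction_on with
        | zero => simp
        | tmul y a => simp
        | add a b ha hb => simp only [map_add, TensorProduct.add_tmul, ha, hb]
      | add a b ha hb => simp only [map_add, ha, hb]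
    have h2 : ∀ s : X ⊗[k] D, (TensorProduct.map i i).lTensor X
        ((Coalgebra.comul (R := k) (A := D)).lTensor X s) =
        (Coalgebra.comul (R := k) (A := B)).lTensor X (i.lTensor X s) := by
      intro s
      rw [← LinearMap.comp_apply, ← LinearMap.comp_apply, ← LinearMap.lTensor_comp,
        ← LinearMap.lTensor_comp]
      congr 2
      exact CoalgHomClass.map_comp_comul ι
    apply hii
    rw [h1, h2, hc, ρ.coassoc]
  · rw [← ρ.counit x, ← hc, ← LinearMap.comp_apply (LinearMap.lTensor X _) (LinearMap.lTensor X i),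
      ← LinearMap.lTensor_comp]
    congr 2
    exact (CoalgHomClass.counit_comp ι).symm

/-- If `G / N` is linearly reductive, then submodules of a `G`-module on which `N` acts trivially
have complements. -/
theorem exists_isStable_isCompl [FiniteDimensional k X] (q : B →ₐc[k] C) (ι : D →ₐc[k] B)
    (hι : IsQuotient q ι) (hD : IsLinearlyReductive k D) (ρ : GMod k B X)
    (h : ∀ x, (ρ.restrict q).coact x = x ⊗ₜ 1) (W : Submodule k X) (hW : ρ.IsStable W) :
    ∃ W' : Submodule k X, ρ.IsStable W' ∧ IsCompl W W' := by
  obtain ⟨σ, rfl⟩ := exists_restrict_eq q ι hι ρ h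
  have hWσ : σ.IsStable W := by
    rw [isStable_iff_rTensor_mkQ] at hW ⊢
    intro w hw
    apply Module.Flat.lTensor_preserves_injective_linearMap (M := X ⧸ W) (ι : D →ₗ[k] B)
      hι.injective
    rw [lTensor_rTensor_comm, ← restrict_coact, hW w hw, map_zero]
  obtain ⟨W', hW', hc⟩ := hD X σ W hWσ
  exact ⟨W', hW'.restrict ι, hc⟩

/-- If `G / N` is linearly reductive, then the projection onto a quotient of a `G`-module on which
`N` acts trivially splits. -/
theorem exists_isHom_section [FiniteDimensional k X] (q : B →ₐc[k] C) (ι : D →ₐc[k] B)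
    (hι : IsQuotient q ι) (hD : IsLinearlyReductive k D) (ρ : GMod k B X)
    (h : ∀ x, (ρ.restrict q).coact x = x ⊗ₜ 1) (W : Submodule k X) (hW : ρ.IsStable W) :
    ∃ s : (X ⧸ W) →ₗ[k] X, (ρ.quot W hW).IsHom ρ s ∧ ∀ y, W.mkQ (s y) = y := by
  obtain ⟨W', hW', hc⟩ := exists_isStable_isCompl q ι hι hD ρ h W hW
  let e := W.quotientEquivOfIsCompl W' hc
  have he : ∀ w : W', e (W.mkQ w) = w := Submodule.quotientEquivOfIsCompl_apply_mk_right hc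
  have hsec : ∀ y, W.mkQ (e y) = y := fun y => e.injective (he (e y))
  refine ⟨W'.subtype ∘ₗ e.toLinearMap, ?_, hsec⟩
  have hs : (ρ.quot W hW).IsHom (ρ.sub W' hW') e.toLinearMap := by
    -- Equivariance of `X ⧸ W ≃ W'` is tested after the surjection `W' → X ⧸ W`, where the composite
    -- is the identity.
    refine isHom_of_comp_surjective (ρ := ρ.sub W' hW') (f := W.mkQ ∘ₗ W'.subtype)
      ((isHom_mkQ ρ W hW).comp (isHom_subtype ρ W' hW'))
      (fun y => ⟨e y, hsec y⟩) ?_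
    convert IsHom.id _ using 1
    ext w : 1
    exact he w
  exact (isHom_subtype ρ W' hW').comp hs

end Quotient

/-! ### The module `X ⊗ Irr(X, M)` and the lifted sequence. -/

theorem restrict_tensor (ρ : GMod k A X) (σ : GMod k A Y) (p : A →ₐc[k] B) :
    (ρ.tensor σ).restrict p = (ρ.restrict p).tensor (σ.restrict p) := by
  have h : ∀ (s : X ⊗[k] A) (t : Y ⊗[k] A),
      (p : A →ₗ[k] B).lTensor (X ⊗[k] Y) (tensorMul k A X Y (s ⊗ₜ t)) =
        tensorMul k B X Y ((p : A →ₗ[k] B).lTensor X s ⊗ₜ (p : A →ₗ[k] B).lTensor Y t) := by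
    intro s t
    induction s using TensorProduct.induction_on with
    | zero => simp
    | tmul x a =>
      induction t using TensorProduct.induction_on with
      | zero => simp
      | tmul y b => simp [tensorMul]
      | add a b ha hb => simp only [map_add, TensorProduct.tmul_add, ha, hb]
    | add a b ha hb => simp only [map_add, TensorProduct.add_tmul, ha, hb]
  ext z
  induction z using TensorProduct.induction_on with
  | zero => simp
  | tmul x y => exact h _ _
  | add a b ha hb => simp only [map_add, ha, hb]

theorem IsHom.lTensor {σ : GMod k B Y} {τ : GMod k B Z} {f : Y →ₗ[k] Z} (ρ : GMod k B X)
    (hf : σ.IsHom τ f) : (ρ.tensor σ).IsHom (ρ.tensor τ) (f.lTensor X) := by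
  have h : ∀ (s : X ⊗[k] B) (t : Y ⊗[k] B), tensorMul k B X Z (s ⊗ₜ f.rTensor B t) =
      (f.lTensor X).rTensor B (tensorMul k B X Y (s ⊗ₜ t)) := by
    intro s t
    induction s using TensorProduct.induction_on with
    | zero => simp
    | tmul x a =>
      induction t using TensorProduct.induction_on with
      | zero => simp
      | tmul y b => simp [tensorMul]
      | add a b ha hb => simp only [map_add, TensorProduct.tmul_add, ha, hb]
    | add a b ha hb => simp only [map_add, TensorProduct.add_tmul, ha, hb]
  intro z
  induction z using TensorProduct.induction_on with
  | zero => simp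
  | tmul x y =>
    refine Eq.trans ?_ (h (ρ.coact x) (σ.coact y))
    rw [← hf]
    rfl
  | add a b ha hb => simp only [map_add, ha, hb]

/-- Tensoring with an invariant vector is a homomorphism. -/
theorem isHom_mk_flip (ρ : GMod k B X) (σ : GMod k B Y) {y : Y} (hy : σ.coact y = y ⊗ₜ 1) :
    ρ.IsHom (ρ.tensor σ) ((TensorProduct.mk k X Y).flip y) := by
  have h : ∀ s : X ⊗[k] B, tensorMul k B X Y (s ⊗ₜ (y ⊗ₜ 1)) =
      ((TensorProduct.mk k X Y).flip y).rTensor B s := by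
    intro s
    induction s using TensorProduct.induction_on with
    | zero => simp
    | tmul x a => simp [tensorMul]
    | add a b ha hb => simp only [map_add, TensorProduct.add_tmul, ha, hb]
  intro x
  rw [← h, ← hy]
  rfl

/-- The normal subgroup scheme acts trivially on the space of its radical homomorphisms. -/
theorem restrict_sub_radical_coact [FiniteDimensional k X] (q : B →ₐc[k] C) (ρ : GMod k B X)
    (σ : GMod k B Y) (h : (ρ.hom σ).IsStable (radical (ρ.restrict q) (σ.restrict q)))
    (u : radical (ρ.restrict q) (σ.restrict q)) :
    (((ρ.hom σ).sub _ h).restrict q).coact u = u ⊗ₜ 1 := by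
  apply rTensor_subtype_injective
  rw [← (isHom_subtype _ _ h).restrict q u, restrict_hom]
  exact (isHom_iff_hom_coact _ _ _).1 u.2.1

theorem restrict_irr_coact [FiniteDimensional k X] (q : B →ₐc[k] C) (ρ : GMod k B X)
    (σ : GMod k B Y) (h₁ : (ρ.hom σ).IsStable (radical (ρ.restrict q) (σ.restrict q)))
    (h₂ : (ρ.hom σ).IsStable (radicalSq (ρ.restrict q) (σ.restrict q)))
    (y : Irr (ρ.restrict q) (σ.restrict q)) :
    ((irr q ρ σ h₁ h₂).restrict q).coact y = y ⊗ₜ 1 := by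
  obtain ⟨u, rfl⟩ := Submodule.mkQ_surjective _ y
  refine ((isHom_mkQ _ _ (isStable_comap _ h₁ h₂)).restrict q u).trans ?_
  rw [restrict_sub_radical_coact]
  simp

/-- The classes of the components of the middle map of an almost split sequence form a basis of the
space of irreducible maps. -/
theorem exists_basis_irr [IsAlgClosed k] {T : Type u} [AddCommGroup T] [Module k T]
    [FiniteDimensional k X] [FiniteDimensional k Y] [FiniteDimensional k T]
    {ρ : GMod k C X} {σ : GMod k C Y} {τ : GMod k C T} {n : ℕ} {f : T →ₗ[k] (Fin n → X)}
    {g : (Fin n → X) →ₗ[k] Y} (hX : ρ.IsIndecomposable)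
    (hE : IsAlmostSplit τ (ρ.power n) σ f g) :
    ∃ (b : Module.Basis (Fin n) k (Irr ρ σ)) (v : Fin n → radical ρ σ),
      (∀ i, (v i : X →ₗ[k] Y) = g ∘ₗ LinearMap.single k (fun _ => X) i) ∧
      ∀ i, b i = Submodule.Quotient.mk (v i) := by
  have hEx := hE.isShortExact
  let v : Fin n → radical ρ σ := fun i => ⟨g ∘ₗ LinearMap.single k (fun _ => X) i,
    homs_le_radical hX hE.right hEx.isHom_right hEx.surjective
      (hEx.isHom_right.comp (IsHom.single ρ i))⟩
  let W := (radicalSq ρ σ).comap (radical ρ σ).subtype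
  have hli : LinearIndependent k (fun i => W.mkQ (v i)) := by
    rw [Fintype.linearIndependent_iff]
    intro c hc
    have h0 : W.mkQ (∑ i, c i • v i) = 0 := by simpa using hc
    rw [Submodule.mkQ_apply, Submodule.Quotient.mk_eq_zero, Submodule.mem_comap] at h0
    refine congrFun (eq_zero_of_sum_mem_radicalSq hX hE c ?_)
    simpa [v] using h0
  have hsp : ⊤ ≤ Submodule.span k (Set.range fun i => W.mkQ (v i)) := by
    rintro y -
    obtain ⟨u, rfl⟩ := W.mkQ_surjective y
    obtain ⟨c, hc⟩ := exists_sub_sum_mem_radicalSq hX hE.right hEx.isHom_right hEx.surjective u.2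
    have h0 : u - ∑ i, c i • v i ∈ W := by
      simpa [W, v] using hc
    have h1 : W.mkQ u = ∑ i, c i • W.mkQ (v i) := by
      simp only [← map_smul, ← map_sum]
      exact (Submodule.Quotient.eq W).2 h0
    rw [h1]
    exact Submodule.sum_mem _ fun i _ => Submodule.smul_mem _ _ (Submodule.subset_span ⟨i, rfl⟩)
  exact ⟨Module.Basis.mk hli hsp, v, fun _ => rfl, fun i => by rw [Module.Basis.mk_apply]; rfl⟩

/-- A linear map `X ⊗ Irr(X, Y) → Y` given by representatives of irreducible maps is isomorphic to
the right almost split map. -/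
theorem exists_linearEquiv_tensor_irr [IsAlgClosed k] {T : Type u} [AddCommGroup T] [Module k T]
    [FiniteDimensional k X] [FiniteDimensional k Y] [FiniteDimensional k T]
    {ρ : GMod k C X} {σ : GMod k C Y} {τ : GMod k C T} {n : ℕ} {f : T →ₗ[k] (Fin n → X)}
    {g : (Fin n → X) →ₗ[k] Y} (hX : ρ.IsIndecomposable)
    (hE : IsAlmostSplit τ (ρ.power n) σ f g) (s : Irr ρ σ →ₗ[k] radical ρ σ)
    (hs : ∀ y, Submodule.Quotient.mk (s y) = y) (υ : GMod k C (Irr ρ σ))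
    (hυ : ∀ y, υ.coact y = y ⊗ₜ 1) (ψ : X ⊗[k] Irr ρ σ →ₗ[k] Y)
    (hψ : ∀ x y, ψ (x ⊗ₜ y) = (s y : X →ₗ[k] Y) x) :
    ∃ θ : (Fin n → X) ≃ₗ[k] X ⊗[k] Irr ρ σ,
      (ρ.power n).IsHom (ρ.tensor υ) θ.toLinearMap ∧ ψ ∘ₗ θ.toLinearMap = g := by
  have hEx := hE.isShortExact
  obtain ⟨b, v, hv, hb⟩ := exists_basis_irr hX hE
  have hsr : ∀ i, ∃ r : Fin n → X →ₗ[k] X, (∀ j, r j ∈ radical ρ ρ) ∧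
      (s (b i) - v i : X →ₗ[k] Y) = g ∘ₗ LinearMap.pi r := by
    intro i
    refine (mem_radicalSq_iff hX hE.right hEx.isHom_right hEx.surjective _).1 ?_
    have := (Submodule.Quotient.eq ((radicalSq ρ σ).comap (radical ρ σ).subtype)).1
      ((hs (b i)).trans (hb i))
    exact this
  choose r hr hsr using hsr
  -- The identification given by the basis of classes of components of `g`; it is a homomorphism
  -- because `υ` is trivial.
  let ε : (Fin n → X) ≃ₗ[k] X ⊗[k] Irr ρ σ :=
    (Finsupp.linearEquivFunOnFinite k X (Fin n)).symm ≪≫ₗ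
      (TensorProduct.equivFinsuppOfBasisRight b).symm
  have hε : ε.toLinearMap =
      ∑ i, (TensorProduct.mk k X (Irr ρ σ)).flip (b i) ∘ₗ LinearMap.proj i := by
    ext i x
    simp only [ε, LinearMap.comp_apply, LinearMap.single_apply, LinearEquiv.coe_coe,
      LinearEquiv.trans_apply, Finsupp.linearEquivFunOnFinite_symm_single,
      TensorProduct.equivFinsuppOfBasisRight_symm_apply, LinearMap.sum_apply,
      LinearMap.proj_apply, LinearMap.flip_apply, TensorProduct.mk_apply]
    rw [Finset.sum_eq_single i]
    · simp
    · intro l _ hl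
      simp [Pi.single_eq_of_ne hl]
    · simp
  have hεh : (ρ.power n).IsHom (ρ.tensor υ) ε.toLinearMap := by
    rw [hε]
    exact IsHom.sum fun i _ => (isHom_mk_flip ρ υ (hυ _)).comp (IsHom.proj ρ i)
  -- The chosen representatives satisfy `s (b i) = g i + g ∘ r i`, so `ψ ∘ ε = g ∘ α₀`. As the
  -- matrix `r` is radical, `α₀` is injective by the Nakayama argument, and `ε ∘ α₀⁻¹` is the
  -- required isomorphism.
  let α₀ : (Fin n → X) →ₗ[k] (Fin n → X) :=
    LinearMap.id + ∑ i, LinearMap.pi (r i) ∘ₗ LinearMap.proj i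
  have hα₀ : ∀ x j, α₀ x j = x j + ∑ i, r i j (x i) := by
    intro x j
    simp [α₀, Finset.sum_apply]
  have hαi : Function.Injective α₀ := by
    rw [injective_iff_map_eq_zero]
    intro x hx
    refine eq_zero_of_eq_sum_radical (ρ := ρ) (fun j i => - r i j)
      (fun j i => neg_mem (hr i j)) x fun j => ?_
    have := hα₀ x j
    rw [hx, Pi.zero_apply, eq_comm, add_eq_zero_iff_eq_neg] at this
    rw [this]
    simp
  let α := LinearEquiv.ofBijective α₀ ⟨hαi, LinearMap.injective_iff_surjective.1 hαi⟩
  have hα : (ρ.power n).IsHom (ρ.power n) α.toLinearMap :=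
    Submodule.add_mem ((ρ.power n).homs (ρ.power n)) (IsHom.id _)
      (IsHom.sum fun i _ => (IsHom.pi fun j => (hr i j).1).comp (IsHom.proj ρ i))
  have hψε : ψ ∘ₗ ε.toLinearMap = g ∘ₗ α.toLinearMap := by
    rw [hε]
    ext i x
    have h1 := LinearMap.congr_fun (hsr i) x
    have h2 : α (Pi.single i x) = Pi.single i x + fun j => r i j x := by
      funext j
      refine (hα₀ _ j).trans ?_
      rw [Finset.sum_eq_single i]
      · simp
      · intro l _ hl
        simp [Pi.single_eq_of_ne hl]
      · simp
    simp only [LinearMap.comp_apply, LinearMap.single_apply, LinearEquiv.coe_coe, h2, map_add]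
    rw [LinearMap.sum_apply, map_sum, Finset.sum_eq_single i]
    · simp only [LinearMap.comp_apply, LinearMap.proj_apply, Pi.single_eq_same,
        LinearMap.flip_apply, TensorProduct.mk_apply, hψ]
      rw [LinearMap.sub_apply, hv, sub_eq_iff_eq_add'] at h1
      exact h1
    · intro l _ hl
      simp [Pi.single_eq_of_ne hl]
    · simp
  refine ⟨α.symm ≪≫ₗ ε, hεh.comp (isHom_symm α hα), ?_⟩
  refine LinearMap.ext fun x => ?_
  have := LinearMap.congr_fun hψε (α.symm x)
  simpa using this

/-- If `G / N` is linearly reductive, an almost split sequence `0 → T → Xⁿ → M → 0` over `N` is the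
restriction of an exact sequence over `G` with middle term `X ⊗ Irr_N(X, M)`. -/
theorem exists_shortExact_irr {M T : Type u} [IsAlgClosed k]
    [AddCommGroup M] [Module k M] [AddCommGroup T] [Module k T]
    [FiniteDimensional k X] [FiniteDimensional k M] [FiniteDimensional k T]
    (q : B →ₐc[k] C) (ι : D →ₐc[k] B) (hι : IsQuotient q ι) (hD : IsLinearlyReductive k D)
    (ρX : GMod k B X) (ρM : GMod k B M) (ρT : GMod k C T)
    (hX : (ρX.restrict q).IsIndecomposable)
    (n : ℕ) (f : T →ₗ[k] (Fin n → X)) (g : (Fin n → X) →ₗ[k] M)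
    (hE : IsAlmostSplit ρT ((ρX.restrict q).power n) (ρM.restrict q) f g)
    (h₁ : (ρX.hom ρM).IsStable (radical (ρX.restrict q) (ρM.restrict q)))
    (h₂ : (ρX.hom ρM).IsStable (radicalSq (ρX.restrict q) (ρM.restrict q))) :
    ∃ (K : Type u) (_ : AddCommGroup K) (_ : Module k K) (ρK : GMod k B K)
      (φ : K →ₗ[k] X ⊗[k] Irr (ρX.restrict q) (ρM.restrict q))
      (ψ : X ⊗[k] Irr (ρX.restrict q) (ρM.restrict q) →ₗ[k] M),
      IsShortExact ρK (ρX.tensor (irr q ρX ρM h₁ h₂)) ρM φ ψ ∧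
      ∃ (a : T ≃ₗ[k] K)
        (θ : (Fin n → X) ≃ₗ[k] X ⊗[k] Irr (ρX.restrict q) (ρM.restrict q)),
        ρT.IsHom (ρK.restrict q) a.toLinearMap ∧
        ((ρX.restrict q).power n).IsHom
          ((ρX.tensor (irr q ρX ρM h₁ h₂)).restrict q) θ.toLinearMap ∧
        θ.toLinearMap ∘ₗ f = φ ∘ₗ a.toLinearMap ∧ ψ ∘ₗ θ.toLinearMap = g := by
  have hEx := hE.isShortExact
  obtain ⟨s, hs, hsec⟩ := exists_isHom_section q ι hι hD ((ρX.hom ρM).sub _ h₁)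
    (restrict_sub_radical_coact q ρX ρM h₁) _ (isStable_comap _ h₁ h₂)
  -- Evaluation at the representatives chosen by the equivariant section `s`; equivariance of `s`
  -- makes `ψ` a homomorphism over `G`, not just over `N`.
  let ψ : X ⊗[k] Irr (ρX.restrict q) (ρM.restrict q) →ₗ[k] M :=
    TensorProduct.lift (LinearMap.id (R := k) (M := X →ₗ[k] M)).flip ∘ₗ
      ((radical (ρX.restrict q) (ρM.restrict q)).subtype ∘ₗ s).lTensor X
  have hψ : (ρX.tensor (irr q ρX ρM h₁ h₂)).IsHom ρM ψ :=
    (isHom_eval ρX ρM).comp (((isHom_subtype _ _ h₁).comp hs).lTensor ρX)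
  obtain ⟨θ, hθ, hψθ⟩ := exists_linearEquiv_tensor_irr hX hE s hsec
    ((irr q ρX ρM h₁ h₂).restrict q) (restrict_irr_coact q ρX ρM h₁ h₂) ψ (fun x y => by simp [ψ])
  have hψθ' : ∀ x, ψ (θ x) = g x := LinearMap.congr_fun hψθ
  rw [← restrict_tensor] at hθ
  have hK := isStable_ker hψ
  let a₀ : T →ₗ[k] LinearMap.ker ψ := (θ.toLinearMap ∘ₗ f).codRestrict _ fun t => by
    rw [LinearMap.mem_ker]
    exact (hψθ' _).trans (hEx.exact.apply_apply_eq_zero t)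
  have ha₀ : Function.Bijective a₀ := by
    constructor
    · intro t t' h
      exact hEx.injective (θ.injective (congrArg Subtype.val h))
    · rintro ⟨z, hz⟩
      obtain ⟨x, rfl⟩ := θ.surjective z
      obtain ⟨t, rfl⟩ := (hEx.exact x).1 ((hψθ' x).symm.trans hz)
      exact ⟨t, rfl⟩
  refine ⟨LinearMap.ker ψ, inferInstance, inferInstance, GMod.sub _ _ hK, (LinearMap.ker ψ).subtype,
    ψ, ⟨isHom_subtype _ _ hK, hψ, Subtype.val_injective, LinearMap.exact_subtype_ker_map ψ,
      fun m => ?_⟩, LinearEquiv.ofBijective a₀ ha₀, θ, ?_, hθ, rfl, hψθ⟩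
  · obtain ⟨x, rfl⟩ := hEx.surjective m
    exact ⟨θ x, hψθ' x⟩
  · exact isHom_of_injective_comp ((isHom_subtype _ _ hK).restrict q) Subtype.val_injective
      (hθ.comp hEx.isHom_left)

end GMod

end GroupSchemeModule

end

/-! ### The theorem. -/

open GroupSchemeModule in
theorem mainTheorem6 {k A B C D X M T : Type u} [Field k] [IsAlgClosed k]
    [CommRing A] [HopfAlgebra k A] [IsReduced A]
    [CommRing B] [HopfAlgebra k B] [Module.Finite k B]
    [CommRing C] [HopfAlgebra k C]
    [CommRing D] [HopfAlgebra k D]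
    [AddCommGroup X] [Module k X] [FiniteDimensional k X]
    [AddCommGroup M] [Module k M] [FiniteDimensional k M]
    [AddCommGroup T] [Module k T] [FiniteDimensional k T]
    (p : A →ₐc[k] B) (hp : Function.Surjective p)
    (q : B →ₐc[k] C) (hq : Function.Surjective q)
    (hN : IsNormal (q.comp p))
    (ι : D →ₐc[k] B) (hι : IsQuotient q ι) (hD : IsLinearlyReductive k D)
    (ρX : GMod k B X) (ρM : GMod k B M) (ρT : GMod k C T)
    (hX : (ρX.restrict q).IsIndecomposable)
    (n : ℕ) (f : T →ₗ[k] (Fin n → X)) (g : (Fin n → X) →ₗ[k] M)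
    (hE : IsAlmostSplit ρT ((ρX.restrict q).power n) (ρM.restrict q) f g) :
    ∃ h₁ : (ρX.hom ρM).IsStable (GMod.radical (ρX.restrict q) (ρM.restrict q)),
      ((∃ σX : GMod k A X, σX.restrict p = ρX) → (∃ σM : GMod k A M, σM.restrict p = ρM) →
        (ρX.hom ρM).IsStable (GMod.radicalSq (ρX.restrict q) (ρM.restrict q))) ∧
      ∀ h₂ : (ρX.hom ρM).IsStable (GMod.radicalSq (ρX.restrict q) (ρM.restrict q)),
        ∃ (K : Type u) (_ : AddCommGroup K) (_ : Module k K) (ρK : GMod k B K)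
          (φ : K →ₗ[k] X ⊗[k] GMod.Irr (ρX.restrict q) (ρM.restrict q))
          (ψ : X ⊗[k] GMod.Irr (ρX.restrict q) (ρM.restrict q) →ₗ[k] M),
          IsShortExact ρK (ρX.tensor (GMod.irr q ρX ρM h₁ h₂)) ρM φ ψ ∧
          ∃ (a : T ≃ₗ[k] K)
            (θ : (Fin n → X) ≃ₗ[k] X ⊗[k] GMod.Irr (ρX.restrict q) (ρM.restrict q)),
            ρT.IsHom (ρK.restrict q) a.toLinearMap ∧
            ((ρX.restrict q).power n).IsHom
              ((ρX.tensor (GMod.irr q ρX ρM h₁ h₂)).restrict q) θ.toLinearMap ∧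
            θ.toLinearMap ∘ₗ f = φ ∘ₗ a.toLinearMap ∧ ψ ∘ₗ θ.toLinearMap = g := by
  have hEx := hE.isShortExact
  refine ⟨?_, ?_, fun h₂ => GMod.exists_shortExact_irr q ι hι hD ρX ρM ρT hX n f g hE _ h₂⟩
  · rw [GMod.homs_eq_radical hX hE.right hEx.isHom_right hEx.surjective]
    exact GMod.isStable_homs ρX ρM q (GMod.isNormal_of_comp p hp q hN)
  · rintro ⟨σX, rfl⟩ ⟨σM, rfl⟩
    have hg := hE.right
    have hgh := hEx.isHom_right
    rw [← GMod.restrict_hom]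
    simp only [GMod.restrict_restrict] at hX hg hgh ⊢
    -- Stability is proved over `H`, whose coordinate ring is reduced, and only then restricted to
    -- `G`.
    exact (GMod.isStable_radicalSq σX σM (q.comp p) hN hX hg hgh hEx.surjective).restrict p
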